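/- For each $n\ge 1$ let $(X^{(n)}_t)_{t=0,1,2,\dots}$ be a discrete-time Markov chain on $\{0,1,\dots,N_n\}$, $N_n\ge 1$, with transition kernel $P_n$, that is an irreducible birth-and-death chain ($P_n(x,y)=0$ whenever $|x-y|>1$) and lazy ($P_n(x,x)\ge \frac12$ for all $x$). Let $\pi_n$ be its stationary distribution, $d_n(t)=\max_x \|P_n^t(x,\cdot)-\pi_n\|_{\mathrm{TV}}$, $t^{(n)}_{\mathrm{mix}}(\epsilon)=\min\{t\in\{0,1,2,\dots\}: d_n(t)\le \epsilon\}$ for $0<\epsilon<1$, and $t^{(n)}_{\mathrm{mix}}=t^{(n)}_{\mathrm{mix}}(\frac14)$. Let $\mathrm{gap}(n)=1-\lambda_n$, where $\lambda_n$ is the largest absolute value of an eigenvalue of $P_n$ other than the trivial eigenvalue $1$, and let $t^{(n)}_{\mathrm{rel}}=1/\mathrm{gap}(n)$. Then the sequence exhibits total-variation cutoff, i.e. $\lim_{n\to\infty} t^{(n)}_{\mathrm{mix}}(\epsilon)/t^{(n)}_{\mathrm{mix}}(1-\epsilon)=1$ for every $0<\epsilon<1$, if and only if $t^{(n)}_{\mathrm{mix}}\cdot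 \mathrm{gap}(n)\to\infty$ as $n\to\infty$. Furthermore, if the sequence exhibits cutoff, then $w_n=\sqrt{t^{(n)}_{\mathrm{mix}}\cdot t^{(n)}_{\mathrm{rel}}}$ is a cutoff window for it: $w_n=o\big(t^{(n)}_{\mathrm{mix}}\big)$, and for every $0<\epsilon<1$ there is $c_\epsilon>0$ such that $t^{(n)}_{\mathrm{mix}}(\epsilon)-t^{(n)}_{\mathrm{mix}}(1-\epsilon)\le c_\epsilon w_n$ for all $n$. -/

import Mathlib

open Filter Topology Asymptotics

noncomputable section

namespace BDChain

/-- `P` is the transition kernel of a birth-and-death chain on `{0, …, N}`: a stochastic matrix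
that charges only pairs of states at distance at most one. -/
structure IsBirthDeath {N : ℕ} (P : Matrix (Fin (N + 1)) (Fin (N + 1)) ℝ) : Prop where
  stochastic : P ∈ Matrix.rowStochastic ℝ (Fin (N + 1))
  nearest : ∀ x y : Fin (N + 1), (x : ℕ) + 1 < y ∨ (y : ℕ) + 1 < x → P x y = 0

variable {Ω : Type*} [Fintype Ω] [DecidableEq Ω]

/-- A chain is lazy if it stays in place with probability at least `1 / 2` at every state. -/
def IsLazy (P : Matrix Ω Ω ℝ) : Prop := ∀ x, 1 / 2 ≤ P x x

/-- `p` is a stationary distribution of the chain with transition kernel `P`. -/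
def IsStationary (P : Matrix Ω Ω ℝ) (p : Ω → ℝ) : Prop :=
  p ∈ stdSimplex ℝ Ω ∧ Matrix.vecMul p P = p

/-- Total-variation distance of two distributions on a finite space. -/
def tv (μ ν : Ω → ℝ) : ℝ := 1 / 2 * ∑ x, |μ x - ν x|

/-- Worst-case total-variation distance from `p` at time `t`; the law of the chain at time `t`
started from `x` is the row `(P ^ t) x`. -/
def worstDist (P : Matrix Ω Ω ℝ) (p : Ω → ℝ) (t : ℕ) : ℝ := ⨆ x, tv ((P ^ t) x) p

/-- Mixing time: the least `t` with `worstDist P p t ≤ ε`. -/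
def tmix (P : Matrix Ω Ω ℝ) (p : Ω → ℝ) (ε : ℝ) : ℕ := sInf {t | worstDist P p t ≤ ε}

/-- The largest absolute value of a nontrivial eigenvalue. The eigenvalue `1` of an irreducible
kernel is simple, and an irreducible birth-and-death kernel, being reversible, has only real
eigenvalues. -/
def lam (P : Matrix Ω Ω ℝ) : ℝ :=
  sSup {r | ∃ μ : ℝ, Module.End.HasEigenvalue (Matrix.toLin' P) μ ∧ μ ≠ 1 ∧ r = |μ|}

/-- Spectral gap. -/
def gap (P : Matrix Ω Ω ℝ) : ℝ := 1 - lam P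

/-- Relaxation time. -/
def trel (P : Matrix Ω Ω ℝ) : ℝ := (gap P)⁻¹

/-- Total-variation cutoff, for a family of chains with mixing times `T n ε`. -/
def HasCutoff (T : ℕ → ℝ → ℕ) : Prop :=
  ∀ ε : ℝ, 0 < ε → ε < 1 →
    Tendsto (fun n => (T n ε : ℝ) / (T n (1 - ε) : ℝ)) atTop (𝓝 1)

/-- `w` is a cutoff window, for a family of chains with mixing times `T n ε`. -/
def IsCutoffWindow (T : ℕ → ℝ → ℕ) (w : ℕ → ℝ) : Prop :=
  w =o[atTop] (fun n => (T n (1 / 4) : ℝ)) ∧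
    ∀ ε : ℝ, 0 < ε → ε < 1 →
      ∃ c : ℝ, 0 < c ∧ ∀ n, (T n ε : ℝ) - (T n (1 - ε) : ℝ) ≤ c * w n

end BDChain

end

/-!
For a birth-and-death chain everything is read off the passage times `τ_l` from an end of the
segment to `l`. Both the laws of the chain started at the ends and its stationary distribution are
compared through initial segments, and `τ_l` is concentrated: the Poincaré inequality
`Var_π f ≤ t_rel ℰ(f, f)` gives `Var τ_l ≲ t_rel E τ_l` for `l` below a quantile of `π`, and it
bounds by `O(t_rel)` the mean passage time between two quantiles. By Chebyshev's inequality the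
chain is far from equilibrium before the mean passage time to a low quantile and, started from an
end, close to it after the mean passage time to a high one, up to `O(√(t_mix t_rel))`.

To pass from the ends to all starting points, laziness and reversibility make `y ↦ P^t(x, y) / π y`
unimodal, so that `{y | P^t(x, y) > π y}` is an interval, and the total-variation distance is at
most the sum of the discrepancies of one initial and one final segment. Monotonicity of the chain
makes these largest when the chain starts at an end.

Conversely `λ^t ≤ 2 d(t)`, so that bounded `t_mix · gap` keeps `d` bounded away from `0` at constant
multiples of `t_mix`, and there is no cutoff.
-/

namespace BDChain

open Finset

/-! ### Birth-and-death rates and functions on `{0, …, N}` -/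

/-- Edge rates of a lazy birth-and-death chain on `{0, …, N}` that is reversible with respect to
the probability weights `w`; `u` and `d` are the up and down probabilities. Values beyond `N` are
unconstrained: functions on the state space are encoded as functions on `ℕ`. -/
structure Rates (N : ℕ) (w u d : ℕ → ℝ) : Prop where
  w_pos : ∀ x ≤ N, 0 < w x
  sum_w : ∑ x ∈ range (N + 1), w x = 1
  u_pos : ∀ x < N, 0 < u x
  u_top : u N = 0
  d_zero : d 0 = 0
  lazy : ∀ x ≤ N, u x + d x ≤ 1 / 2
  balance : ∀ x < N, w x * u x = w (x + 1) * d (x + 1)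

/-- One step of the chain, acting on functions. -/
noncomputable def step (u d : ℕ → ℝ) : Module.End ℝ (ℕ → ℝ) where
  toFun f x := f x + u x * (f (x + 1) - f x) + d x * (f (x - 1) - f x)
  map_add' f g := by ext x; simp only [Pi.add_apply]; ring
  map_smul' c f := by ext x; simp only [Pi.smul_apply, smul_eq_mul, RingHom.id_apply]; ring

/-- The mean of a function on `{0, …, N}` under the weights `w`. -/
noncomputable def mean (N : ℕ) (w : ℕ → ℝ) : (ℕ → ℝ) →ₗ[ℝ] ℝ where
  toFun f := ∑ x ∈ range (N + 1), w x * f x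
  map_add' f g := by simp only [Pi.add_apply, mul_add, sum_add_distrib]
  map_smul' c f := by
    simp only [Pi.smul_apply, smul_eq_mul, RingHom.id_apply, mul_sum, mul_left_comm]

/-- The Dirichlet form of the chain with weights `w` and up rates `u`. -/
noncomputable def dirichlet (N : ℕ) (w u f : ℕ → ℝ) : ℝ :=
  ∑ j ∈ range N, w j * u j * (f (j + 1) - f j) ^ 2

/-- The variance of a function on `{0, …, N}` under the weights `w`. -/
noncomputable def variance (N : ℕ) (w f : ℕ → ℝ) : ℝ := mean N w fun x => (f x - mean N w f) ^ 2

/-- Reversal of the state space `{0, …, N}`. -/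
def reflect (N : ℕ) (f : ℕ → ℝ) : ℕ → ℝ := fun x => f (N - x)

/-- The mass of `{0, …, j}`. -/
noncomputable def cum (w : ℕ → ℝ) (j : ℕ) : ℝ := ∑ i ∈ range (j + 1), w i

/-- The indicator function of `{0, …, k}`. -/
noncomputable def below (k : ℕ) : ℕ → ℝ := fun y => if y ≤ k then 1 else 0

/-- The indicator function of `{k, k + 1, …}`. -/
noncomputable def above (k : ℕ) : ℕ → ℝ := fun y => if k ≤ y then 1 else 0

variable {N : ℕ} {w u d : ℕ → ℝ}

lemma step_apply (u d f : ℕ → ℝ) (x : ℕ) :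
    step u d f x = f x + u x * (f (x + 1) - f x) + d x * (f (x - 1) - f x) := rfl

lemma mean_apply (N : ℕ) (w f : ℕ → ℝ) : mean N w f = ∑ x ∈ range (N + 1), w x * f x := rfl

lemma pow_step_const (t : ℕ) (a : ℝ) : (step u d ^ t) (fun _ => a) = fun _ => a := by
  induction t with
  | zero => rfl
  | succ t ih => rw [pow_succ, Module.End.mul_apply, show step u d (fun _ => a) = fun _ => a by
      ext x; simp [step_apply], ih]

lemma mean_single {x : ℕ} (hx : x ≤ N) (w : ℕ → ℝ) : mean N w (Pi.single x 1) = w x := by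
  simp [mean_apply, Pi.single_apply, Nat.lt_succ_iff.2 hx]

lemma above_succ (k : ℕ) : above (k + 1) = (fun _ => 1) - below k := by
  ext y
  simp only [above, below, Pi.sub_apply]
  split_ifs <;> first | omega | norm_num

lemma mean_below {k : ℕ} (hk : k ≤ N) (w : ℕ → ℝ) : mean N w (below k) = cum w k := by
  simp only [mean_apply, below, cum, mul_ite, mul_one, mul_zero, ← sum_filter]
  exact sum_congr (by ext; simp; omega) fun _ _ => rfl

lemma reflect_reflect {f : ℕ → ℝ} {x : ℕ} (hx : x ≤ N) : reflect N (reflect N f) x = f x := by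
  simp only [reflect, Nat.sub_sub_self hx]

lemma mean_reflect (N : ℕ) (w f : ℕ → ℝ) : mean N (reflect N w) f = mean N w (reflect N f) := by
  rw [mean_apply, mean_apply, ← sum_range_reflect (fun x => w x * reflect N f x),
    Nat.add_sub_cancel]
  exact sum_congr rfl fun x hx => congrArg (_ * ·) (reflect_reflect (by grind)).symm

lemma variance_reflect (N : ℕ) (w f : ℕ → ℝ) :
    variance N (reflect N w) f = variance N w (reflect N f) := by
  rw [variance, mean_reflect, mean_reflect]
  rfl

lemma reflect_below {a : ℕ} (ha : a ≤ N) : reflect N (below (N - a)) = above a := by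
  ext y
  simp only [reflect, below, above, tsub_le_tsub_iff_left ha]

namespace Rates

lemma u_nonneg (h : Rates N w u d) {x : ℕ} (hx : x ≤ N) : 0 ≤ u x := by
  rcases hx.lt_or_eq with hx | rfl
  · exact (h.u_pos x hx).le
  · exact h.u_top.ge

lemma d_pos (h : Rates N w u d) {x : ℕ} (hx : x < N) : 0 < d (x + 1) := by
  have hedge := mul_pos (h.w_pos x hx.le) (h.u_pos x hx)
  rw [h.balance x hx] at hedge
  exact pos_of_mul_pos_right hedge (h.w_pos _ hx).le

lemma d_nonneg (h : Rates N w u d) {x : ℕ} (hx : x ≤ N) : 0 ≤ d x := by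
  rcases x with _ | x
  · exact h.d_zero.ge
  · exact (h.d_pos hx).le

protected lemma reflect (h : Rates N w u d) :
    Rates N (reflect N w) (reflect N d) (reflect N u) where
  w_pos x _ := h.w_pos _ (N.sub_le x)
  sum_w := by
    rw [← h.sum_w, ← sum_range_reflect w (N + 1)]
    simp [reflect]
  u_pos x hx := by
    have := h.d_pos (x := N - x - 1) (by omega)
    rwa [show N - x - 1 + 1 = N - x by omega] at this
  u_top := by simpa [reflect] using h.d_zero
  d_zero := by simpa [reflect] using h.u_top
  lazy x _ := by rw [add_comm]; exact h.lazy _ (N.sub_le x)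
  balance x hx := by
    have := h.balance (N - (x + 1)) (by omega)
    rw [show N - (x + 1) + 1 = N - x by omega] at this
    exact this.symm

lemma edge_pos (h : Rates N w u d) {j : ℕ} (hj : j < N) : 0 < w j * u j :=
  mul_pos (h.w_pos j hj.le) (h.u_pos j hj)

lemma cum_pos (h : Rates N w u d) {j : ℕ} (hj : j ≤ N) : 0 < cum w j :=
  sum_pos (fun i hi => h.w_pos i (by grind)) ⟨0, by simp⟩

lemma cum_mono (h : Rates N w u d) {i j : ℕ} (hij : i ≤ j) (hj : j ≤ N) : cum w i ≤ cum w j :=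
  sum_le_sum_of_subset_of_nonneg (by simpa using hij) fun k hk _ => (h.w_pos k (by grind)).le

lemma cum_top (h : Rates N w u d) : cum w N = 1 := h.sum_w

lemma mean_const (h : Rates N w u d) (a : ℝ) : mean N w (fun _ => a) = a := by
  rw [mean_apply, ← sum_mul, h.sum_w, one_mul]

lemma mean_mono (h : Rates N w u d) {f g : ℕ → ℝ} (hfg : ∀ x ≤ N, f x ≤ g x) :
    mean N w f ≤ mean N w g :=
  sum_le_sum (s := range (N + 1)) fun x hx =>
    mul_le_mul_of_nonneg_left (hfg x (by grind)) (h.w_pos x (by grind)).le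

lemma variance_eq (h : Rates N w u d) (f : ℕ → ℝ) :
    variance N w f = mean N w (fun x => f x ^ 2) - mean N w f ^ 2 := by
  set m := mean N w f with hm
  have hexpand : (fun x => (f x - m) ^ 2) =
      (fun x => f x ^ 2) - (2 * m) • f + fun _ => m ^ 2 := by
    ext x; simp only [Pi.add_apply, Pi.sub_apply, Pi.smul_apply, smul_eq_mul]; ring
  rw [variance, ← hm, hexpand, map_add, map_sub, map_smul, h.mean_const, ← hm, smul_eq_mul]
  ring

/-! ### The step operator -/

lemma step_le_step (h : Rates N w u d) {f g : ℕ → ℝ} {x : ℕ} (hx : x ≤ N) (h₀ : f x ≤ g x)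
    (h₁ : x < N → f (x + 1) ≤ g (x + 1)) (h₂ : f (x - 1) ≤ g (x - 1)) :
    step u d f x ≤ step u d g x := by
  have hup : u x * f (x + 1) ≤ u x * g (x + 1) := by
    rcases hx.lt_or_eq with hx' | rfl
    · exact mul_le_mul_of_nonneg_left (h₁ hx') (h.u_nonneg hx)
    · simp [h.u_top]
  have hdown := mul_le_mul_of_nonneg_left h₂ (h.d_nonneg hx)
  have hstay := mul_le_mul_of_nonneg_left h₀ (show 0 ≤ 1 - u x - d x by linarith [h.lazy x hx])
  simp only [step_apply]
  linarith

lemma pow_step_mono (h : Rates N w u d) (t : ℕ) {f g : ℕ → ℝ} (hfg : ∀ x ≤ N, f x ≤ g x) :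
    ∀ x ≤ N, (step u d ^ t) f x ≤ (step u d ^ t) g x := by
  induction t generalizing f g with
  | zero => exact hfg
  | succ _ ih =>
    exact ih fun x hx => h.step_le_step hx (hfg x hx) (hfg (x + 1)) (hfg _ (by omega))

lemma pow_step_congr (h : Rates N w u d) (t : ℕ) {f g : ℕ → ℝ} (hfg : ∀ x ≤ N, f x = g x) :
    ∀ x ≤ N, (step u d ^ t) f x = (step u d ^ t) g x := fun x hx =>
  (h.pow_step_mono t (fun y hy => (hfg y hy).le) x hx).antisymm
    (h.pow_step_mono t (fun y hy => (hfg y hy).ge) x hx)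

lemma pow_step_le (h : Rates N w u d) (t : ℕ) {f : ℕ → ℝ} {a : ℝ} (hf : ∀ x ≤ N, f x ≤ a) :
    ∀ x ≤ N, (step u d ^ t) f x ≤ a := by
  simpa only [pow_step_const] using h.pow_step_mono t (g := fun _ => a) hf

lemma le_pow_step (h : Rates N w u d) (t : ℕ) {f : ℕ → ℝ} {a : ℝ} (hf : ∀ x ≤ N, a ≤ f x) :
    ∀ x ≤ N, a ≤ (step u d ^ t) f x := by
  simpa only [pow_step_const] using h.pow_step_mono t (f := fun _ => a) hf

lemma pow_step_reflect (h : Rates N w u d) (t : ℕ) (f : ℕ → ℝ) : ∀ x ≤ N,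
    (step (reflect N d) (reflect N u) ^ t) (reflect N f) x = reflect N ((step u d ^ t) f) x := by
  induction t with
  | zero => intro x _; rfl
  | succ t ih =>
    intro x hx
    have hstep := h.reflect.pow_step_congr 1 ih x hx
    simp only [pow_one] at hstep
    rw [pow_succ', pow_succ', Module.End.mul_apply, Module.End.mul_apply, hstep]
    simp only [step_apply, reflect, Nat.sub_add_eq]
    rcases x with _ | x
    · simp [h.u_top]
    · rw [show N - (x + 1 - 1) = N - (x + 1) + 1 by omega, Nat.sub_add_eq]
      ring

/-! ### Reversibility -/

lemma mean_mul_step_sub (h : Rates N w u d) (f g : ℕ → ℝ) :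
    mean N w (g * (step u d f - f)) =
      -∑ j ∈ range N, w j * u j * ((f (j + 1) - f j) * (g (j + 1) - g j)) := by
  have hpartial : ∀ n ≤ N, ∑ x ∈ range (n + 1), w x * (g x * (step u d f x - f x)) =
      w n * u n * g n * (f (n + 1) - f n) -
        ∑ j ∈ range n, w j * u j * ((f (j + 1) - f j) * (g (j + 1) - g j)) := by
    intro n
    induction n with
    | zero => intro _; simp [step_apply, h.d_zero]; ring
    | succ n ih =>
      intro hn
      rw [sum_range_succ, ih (by omega), sum_range_succ _ n]
      simp only [step_apply, Nat.add_sub_cancel]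
      linear_combination -(g (n + 1) * (f n - f (n + 1))) * h.balance n hn
  refine (hpartial N le_rfl).trans ?_
  rw [h.u_top]
  ring

lemma mean_mul_pow_step_comm (h : Rates N w u d) (t : ℕ) (f g : ℕ → ℝ) :
    mean N w (g * (step u d ^ t) f) = mean N w (f * (step u d ^ t) g) := by
  have hone : ∀ f g : ℕ → ℝ, mean N w (g * step u d f) = mean N w (f * step u d g) := by
    intro f g
    have hf := h.mean_mul_step_sub f g
    have hg := h.mean_mul_step_sub g f
    rw [mul_sub, map_sub] at hf hg
    simp only [mul_comm (f (_ + 1) - f _)] at hf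
    rw [mul_comm g f] at hf
    linarith
  induction t generalizing f g with
  | zero => rw [pow_zero, Module.End.one_apply, Module.End.one_apply, mul_comm]
  | succ t ih =>
    rw [pow_succ, Module.End.mul_apply, ih, mul_comm, hone, ← Module.End.mul_apply, ← pow_succ',
      pow_succ]

lemma mean_pow_step (h : Rates N w u d) (t : ℕ) (f : ℕ → ℝ) :
    mean N w ((step u d ^ t) f) = mean N w f := by
  have := h.mean_mul_pow_step_comm t f fun _ => 1
  rw [pow_step_const] at this
  simpa only [← Pi.one_def, one_mul, mul_one] using this

lemma pow_step_single_balance (h : Rates N w u d) (t : ℕ) {x y : ℕ} (hx : x ≤ N) (hy : y ≤ N) :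
    w x * (step u d ^ t) (Pi.single y 1) x = w y * (step u d ^ t) (Pi.single x 1) y := by
  have hsingle : ∀ z ≤ N, ∀ g : ℕ → ℝ, mean N w (Pi.single z 1 * g) = w z * g z := by
    intro z hz g
    rw [← Pi.single_mul_left, one_mul]
    simp [mean_apply, Pi.single_apply, Nat.lt_succ_iff.2 hz]
  rw [← hsingle x hx, ← hsingle y hy, h.mean_mul_pow_step_comm]

end Rates

/-! ### Passage times -/

/-- The mean passage time from `j` to `j + 1`. -/
noncomputable def edgeMean (w u : ℕ → ℝ) (j : ℕ) : ℝ := cum w j / (w j * u j)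

/-- The mean passage time from `0` to `x`. -/
noncomputable def passMean (w u : ℕ → ℝ) (x : ℕ) : ℝ := ∑ j ∈ range x, edgeMean w u j

/-- An upper bound for the variance of the passage time from `j` to `j + 1`: the variance is
smaller by `edgeMean w u j`, which reflects that time is discrete. -/
noncomputable def edgeVar (w u : ℕ → ℝ) (j : ℕ) : ℝ :=
  (2 * ∑ i ∈ range j, w i * u i * edgeMean w u i ^ 2 + w j * u j * edgeMean w u j ^ 2)
    / (w j * u j)

/-- The corresponding upper bound for the variance of the passage time from `0` to `x`. -/
noncomputable def passVar (w u : ℕ → ℝ) (x : ℕ) : ℝ := ∑ j ∈ range x, edgeVar w u j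

/-- An upper bound for the second moment of `T + b`, where `T` is the passage time from `x`
to `l`. -/
noncomputable def passQuad (w u : ℕ → ℝ) (l : ℕ) (b : ℝ) : ℕ → ℝ := fun x =>
  passVar w u l - passVar w u x + (passMean w u l - passMean w u x + b) ^ 2

lemma passMean_succ (w u : ℕ → ℝ) (x : ℕ) :
    passMean w u (x + 1) = passMean w u x + edgeMean w u x := sum_range_succ ..

lemma passVar_succ (w u : ℕ → ℝ) (x : ℕ) :
    passVar w u (x + 1) = passVar w u x + edgeVar w u x := sum_range_succ ..

lemma passQuad_self (w u : ℕ → ℝ) (l : ℕ) (b : ℝ) : passQuad w u l b l = b ^ 2 := by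
  simp [passQuad]

lemma passQuad_neg_passMean_zero (w u : ℕ → ℝ) (l : ℕ) :
    passQuad w u l (-passMean w u l) 0 = passVar w u l := by
  simp [passQuad, passVar, passMean]

namespace Rates

lemma edgeMean_pos (h : Rates N w u d) {j : ℕ} (hj : j < N) : 0 < edgeMean w u j :=
  div_pos (h.cum_pos hj.le) (h.edge_pos hj)

lemma edge_mul_edgeMean (h : Rates N w u d) {j : ℕ} (hj : j < N) :
    w j * u j * edgeMean w u j = cum w j := mul_div_cancel₀ _ (h.edge_pos hj).ne'

lemma edge_mul_edgeVar (h : Rates N w u d) {j : ℕ} (hj : j < N) :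
    w j * u j * edgeVar w u j =
      2 * ∑ i ∈ range j, w i * u i * edgeMean w u i ^ 2 + w j * u j * edgeMean w u j ^ 2 :=
  mul_div_cancel₀ _ (h.edge_pos hj).ne'

lemma edgeVar_nonneg (h : Rates N w u d) {j : ℕ} (hj : j < N) : 0 ≤ edgeVar w u j := by
  have hterm : ∀ i < N, 0 ≤ w i * u i * edgeMean w u i ^ 2 := fun i hi =>
    mul_nonneg (h.edge_pos hi).le (sq_nonneg _)
  exact div_nonneg (add_nonneg (mul_nonneg two_pos.le (sum_nonneg fun i hi =>
    hterm i (by grind))) (hterm j hj)) (h.edge_pos hj).le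

lemma passMean_mono (h : Rates N w u d) {i j : ℕ} (hij : i ≤ j) (hj : j ≤ N) :
    passMean w u i ≤ passMean w u j :=
  sum_le_sum_of_subset_of_nonneg (by simpa using hij) fun k hk _ =>
    (h.edgeMean_pos (by grind)).le

lemma passVar_mono (h : Rates N w u d) {i j : ℕ} (hij : i ≤ j) (hj : j ≤ N) :
    passVar w u i ≤ passVar w u j :=
  sum_le_sum_of_subset_of_nonneg (by simpa using hij) fun k hk _ =>
    h.edgeVar_nonneg (by grind)

lemma up_mul_edgeMean_sub (h : Rates N w u d) {x : ℕ} (hx : x < N) :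
    u x * edgeMean w u x - d x * edgeMean w u (x - 1) = 1 := by
  refine mul_left_cancel₀ (h.w_pos x hx.le).ne' ?_
  have hx₁ := h.edge_mul_edgeMean hx
  rcases x with _ | x
  · simp only [cum, zero_add, sum_range_one, h.d_zero] at hx₁ ⊢
    linarith
  · have hx₀ := h.edge_mul_edgeMean (j := x) (by omega)
    rw [h.balance x (by omega)] at hx₀
    have hcum : cum w (x + 1) = cum w x + w (x + 1) := sum_range_succ ..
    rw [Nat.add_sub_cancel]
    linear_combination hx₁ - hx₀ + hcum

lemma up_mul_edgeVar_sub (h : Rates N w u d) {x : ℕ} (hx : x < N) :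
    u x * edgeVar w u x - d x * edgeVar w u (x - 1) =
      u x * edgeMean w u x ^ 2 + d x * edgeMean w u (x - 1) ^ 2 := by
  refine mul_left_cancel₀ (h.w_pos x hx.le).ne' ?_
  have hx₁ := h.edge_mul_edgeVar hx
  rcases x with _ | x
  · simp only [h.d_zero, range_zero, sum_empty] at hx₁ ⊢
    linarith
  · have hx₀ := h.edge_mul_edgeVar (j := x) (by omega)
    rw [sum_range_succ] at hx₁
    rw [Nat.add_sub_cancel]
    linear_combination
      hx₁ - hx₀ + h.balance x (by omega) * (edgeVar w u x + edgeMean w u x ^ 2)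

lemma step_passQuad_le (h : Rates N w u d) (l : ℕ) (b : ℝ) {x : ℕ} (hx : x < N) :
    step u d (passQuad w u l b) x ≤ passQuad w u l (b - 1) x := by
  have hmean := h.up_mul_edgeMean_sub hx
  have hvar := h.up_mul_edgeVar_sub hx
  have hdown : d x * (passQuad w u l b (x - 1) - passQuad w u l b x) =
      d x * (edgeVar w u (x - 1) + edgeMean w u (x - 1) ^ 2 +
        2 * edgeMean w u (x - 1) * (passMean w u l - passMean w u x + b)) := by
    rcases x with _ | x
    · simp [h.d_zero]
    · simp only [Nat.add_sub_cancel, passQuad, passMean_succ, passVar_succ]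
      ring
  rw [step_apply, hdown]
  simp only [passQuad, passMean_succ, passVar_succ]
  nlinarith [hmean, hvar]

lemma passQuad_nonneg (h : Rates N w u d) {l x : ℕ} (hl : l ≤ N) (hx : x ≤ l) (b : ℝ) :
    0 ≤ passQuad w u l b x :=
  add_nonneg (sub_nonneg.2 (h.passVar_mono hx hl)) (sq_nonneg _)

lemma sq_le_passQuad (h : Rates N w u d) {l x : ℕ} (hl : l ≤ N) (hx : x ≤ l) {b : ℝ}
    (hb : 0 ≤ b) : b ^ 2 ≤ passQuad w u l b x := by
  have hvar := h.passVar_mono hx hl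
  have hmean := h.passMean_mono hx hl
  have hsq : b ^ 2 ≤ (passMean w u l - passMean w u x + b) ^ 2 :=
    pow_le_pow_left₀ hb (by linarith) 2
  rw [passQuad]
  linarith

lemma pow_step_le_passQuad (h : Rates N w u d) {l : ℕ} (hl : l ≤ N) {f : ℕ → ℝ} {τ : ℝ}
    (hf : ∀ x ≤ l, f x ≤ passQuad w u l τ x) (hfl : ∀ t : ℕ, (step u d ^ t) f l ≤ (τ - t) ^ 2)
    (t : ℕ) : ∀ x ≤ l, (step u d ^ t) f x ≤ passQuad w u l (τ - t) x := by
  induction t with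
  | zero => simpa using hf
  | succ t ih =>
    intro x hx
    rcases hx.lt_or_eq with hxl | rfl
    · calc (step u d ^ (t + 1)) f x = step u d ((step u d ^ t) f) x := by
            rw [pow_succ', Module.End.mul_apply]
        _ ≤ step u d (passQuad w u l (τ - t)) x :=
            h.step_le_step (by omega) (ih x hx) (fun _ => ih (x + 1) hxl) (ih (x - 1) (by omega))
        _ ≤ passQuad w u l (τ - t - 1) x := h.step_passQuad_le l _ (by omega)
        _ = passQuad w u l (τ - (t + 1 : ℕ)) x := by push_cast; ring_nf
    · rw [passQuad_self]
      exact hfl (t + 1)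

lemma pow_step_sub_mul_sq_le_passVar (h : Rates N w u d) {l : ℕ} (hl : l ≤ N) {f : ℕ → ℝ} {r : ℝ}
    (hf : ∀ x ≤ l, f x ≤ 1) (hr : 0 ≤ r) (hfl : ∀ t, (step u d ^ t) f l ≤ r) {t : ℕ}
    (ht : passMean w u l ≤ t) :
    ((step u d ^ t) f 0 - r) * (t - passMean w u l) ^ 2 ≤ passVar w u l := by
  set τ := t - passMean w u l with hτ
  have hpow : ∀ s : ℕ, (step u d ^ s) (τ ^ 2 • (f - fun _ => r)) =
      τ ^ 2 • ((step u d ^ s) f - fun _ => r) := fun s => by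
    rw [map_smul, map_sub, pow_step_const]
  have hbound := h.pow_step_le_passQuad hl (f := τ ^ 2 • (f - fun _ => r)) (τ := τ)
    (fun x hx => le_trans ?_ (h.sq_le_passQuad hl hx (sub_nonneg.2 ht))) (fun s => ?_) t 0 l.zero_le
  · rw [hpow, hτ, sub_sub_cancel_left, passQuad_neg_passMean_zero, ← hτ] at hbound
    rw [mul_comm]
    exact hbound
  · exact mul_le_of_le_one_right (sq_nonneg τ) (by simpa using (hf x hx).trans (by linarith))
  · rw [hpow]
    exact (mul_nonpos_of_nonneg_of_nonpos (sq_nonneg τ) (sub_nonpos.2 (hfl s))).trans (sq_nonneg _)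

lemma pow_step_mul_sq_le_passVar (h : Rates N w u d) {l : ℕ} (hl : l ≤ N) {f : ℕ → ℝ}
    (hf : ∀ x ≤ N, f x ≤ 1) (hf₀ : ∀ x < l, f x = 0) {t : ℕ} (ht : t ≤ passMean w u l) :
    (step u d ^ t) f 0 * (t - passMean w u l) ^ 2 ≤ passVar w u l := by
  set τ := t - passMean w u l with hτ
  have hτ₀ : τ ≤ 0 := sub_nonpos.2 ht
  have hbound := h.pow_step_le_passQuad hl (f := τ ^ 2 • f) (τ := τ)
    (fun x hx => ?_) (fun s => ?_) t 0 l.zero_le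
  · rw [map_smul, hτ, sub_sub_cancel_left, passQuad_neg_passMean_zero, ← hτ] at hbound
    rw [mul_comm]
    exact hbound
  · rcases hx.lt_or_eq with hxl | rfl
    · simpa [hf₀ x hxl] using h.passQuad_nonneg hl hx τ
    · rw [passQuad_self]
      exact mul_le_of_le_one_right (sq_nonneg τ) (hf x hl)
  · rw [map_smul]
    refine (mul_le_of_le_one_right (sq_nonneg τ) (h.pow_step_le s hf l hl)).trans ?_
    nlinarith [s.cast_nonneg (α := ℝ)]

end Rates

/-! ### The Poincaré inequality and passage times -/

/-- The Poincaré inequality with relaxation time `r`. -/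
def Poincare (N : ℕ) (w u : ℕ → ℝ) (r : ℝ) : Prop :=
  ∀ f : ℕ → ℝ, variance N w f ≤ r * dirichlet N w u f

/-- The mean time which the chain started at `x` needs for its first passages through those edges
`(i, i + 1)`, `i ∈ s`, that it still has to cross. -/
noncomputable def crossMean (w u : ℕ → ℝ) (s : Finset ℕ) : ℕ → ℝ :=
  ∑ i ∈ s, edgeMean w u i • below i

lemma crossMean_apply (w u : ℕ → ℝ) (s : Finset ℕ) (x : ℕ) :
    crossMean w u s x = ∑ i ∈ s with x ≤ i, edgeMean w u i := by
  simp [crossMean, below, Finset.sum_apply, sum_filter]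

namespace Rates

lemma mean_crossMean {s : Finset ℕ} (hs : s ⊆ range N) (w u : ℕ → ℝ) :
    mean N w (crossMean w u s) = ∑ i ∈ s, edgeMean w u i * cum w i := by
  rw [crossMean, map_sum]
  refine sum_congr rfl fun i hi => ?_
  rw [map_smul, mean_below (mem_range.1 (hs hi)).le, smul_eq_mul]

lemma dirichlet_crossMean (h : Rates N w u d) {s : Finset ℕ} (hs : s ⊆ range N) :
    dirichlet N w u (crossMean w u s) = ∑ i ∈ s, edgeMean w u i * cum w i := by
  have hdiff : ∀ i, crossMean w u s (i + 1) - crossMean w u s i =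
      if i ∈ s then -edgeMean w u i else 0 := by
    intro i
    have hbelow : ∀ j, below j (i + 1) - below j i = if i = j then -1 else 0 := by
      intro j
      simp only [below]
      split_ifs <;> first | omega | norm_num
    simp only [crossMean, Finset.sum_apply, Pi.smul_apply, smul_eq_mul, ← sum_sub_distrib,
      ← mul_sub, hbelow, mul_ite, mul_neg, mul_one, mul_zero, sum_ite_eq]
  simp only [dirichlet, hdiff, ite_pow, neg_sq, zero_pow two_ne_zero, mul_ite, mul_zero,
    ← sum_filter, filter_mem_eq_inter, inter_eq_right.2 hs]
  refine sum_congr rfl fun i hi => ?_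
  rw [← h.edge_mul_edgeMean (mem_range.1 (hs hi))]
  ring

lemma one_sub_cum_mul_sq_mean_le (h : Rates N w u d) {j : ℕ} (hj : j ≤ N) {f : ℕ → ℝ}
    (hf : ∀ x, j < x → f x = 0) :
    (1 - cum w j) * mean N w f ^ 2 ≤ cum w j * variance N w f := by
  have hcut : ∀ g : ℕ → ℝ, (∀ x, j < x → g x = 0) →
      mean N w g = ∑ x ∈ range (j + 1), w x * g x := fun g hg =>
    (sum_subset (range_subset_range.2 (by omega)) fun x _ hx => by
      rw [hg x (by grind), mul_zero]).symm
  have hcs : mean N w f ^ 2 ≤ cum w j * mean N w fun x => f x ^ 2 := by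
    rw [hcut f hf, hcut _ fun x hx => by rw [hf x hx, zero_pow two_ne_zero]]
    have hw : ∀ i ∈ range (j + 1), 0 ≤ w i := fun i hi => (h.w_pos i (by grind)).le
    exact sum_sq_le_sum_mul_sum_of_sq_le_mul _ hw (fun i hi => mul_nonneg (hw i hi) (sq_nonneg _))
      fun i _ => le_of_eq (by ring)
  rw [h.variance_eq]
  linarith

lemma edgeVar_le (h : Rates N w u d) {r δ : ℝ} (hP : Poincare N w u r) (hδ : 0 < δ) {j : ℕ}
    (hj : j < N) (hcum : cum w j ≤ 1 - δ) : edgeVar w u j ≤ 2 * r / δ * edgeMean w u j := by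
  have hs : range (j + 1) ⊆ range N := range_subset_range.2 hj
  set S := ∑ i ∈ range (j + 1), edgeMean w u i * cum w i with hS
  have hS₀ : 0 < S := sum_pos (fun i hi => mul_pos (h.edgeMean_pos (by grind))
    (h.cum_pos (by grind))) nonempty_range_add_one
  have hc := h.cum_pos hj.le
  have hδS : δ * S ≤ cum w j * r := by
    refine le_of_mul_le_mul_right ?_ hS₀
    calc δ * S * S ≤ (1 - cum w j) * S ^ 2 := by nlinarith [sq_nonneg S]
      _ = (1 - cum w j) * mean N w (crossMean w u (range (j + 1))) ^ 2 := by rw [mean_crossMean hs]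
      _ ≤ cum w j * variance N w (crossMean w u (range (j + 1))) :=
          h.one_sub_cum_mul_sq_mean_le hj.le fun x hx => by
            rw [crossMean_apply, filter_false_of_mem (by grind), sum_empty]
      _ ≤ cum w j * (r * S) := by
          rw [hS, ← h.dirichlet_crossMean hs]
          exact mul_le_mul_of_nonneg_left (hP _) hc.le
      _ = cum w j * r * S := by ring
  have hedge : w j * u j * edgeVar w u j ≤ 2 * S := by
    have hterm : ∀ i < N, w i * u i * edgeMean w u i ^ 2 = edgeMean w u i * cum w i :=
      fun i hi => by rw [← h.edge_mul_edgeMean hi]; ring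
    rw [h.edge_mul_edgeVar hj, hterm j hj, sum_congr rfl fun i hi => hterm i (by grind), hS,
      sum_range_succ]
    linarith [mul_pos (h.edgeMean_pos hj) hc]
  refine le_of_mul_le_mul_left ?_ (h.edge_pos hj)
  calc w j * u j * edgeVar w u j ≤ 2 * S := hedge
    _ ≤ 2 * (cum w j * r / δ) := by
        gcongr
        rwa [le_div_iff₀ hδ, mul_comm]
    _ = w j * u j * (2 * r / δ * edgeMean w u j) := by
        rw [← h.edge_mul_edgeMean hj]
        ring

lemma passVar_le (h : Rates N w u d) {r δ : ℝ} (hP : Poincare N w u r) (hδ : 0 < δ) {l : ℕ}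
    (hl : l ≤ N) (hcum : ∀ j < l, cum w j ≤ 1 - δ) :
    passVar w u l ≤ 2 * r / δ * passMean w u l := by
  rw [passVar, passMean, mul_sum]
  refine sum_le_sum fun j hj => ?_
  rw [mem_range] at hj
  exact h.edgeVar_le hP hδ (by omega) (hcum j hj)

lemma mul_sq_sub_le_variance (h : Rates N w u d) {ε α β : ℝ} {f : ℕ → ℝ} {a k : ℕ} (hε : 0 ≤ ε)
    (hak : a ≤ k) (hk : k ≤ N) (hα : ∀ x ≤ a, f x = α) (hβ : ∀ x, k < x → f x = β)
    (ha : ε ≤ cum w a) (hcum : cum w k ≤ 1 - ε) :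
    ε * (α - β) ^ 2 / 2 ≤ variance N w f := by
  set m := mean N w f
  have hpointwise : ∀ x ≤ N, ((α - m) ^ 2 • below a + (β - m) ^ 2 • above (k + 1)) x ≤
      (f x - m) ^ 2 := by
    intro x _
    simp only [Pi.add_apply, Pi.smul_apply, smul_eq_mul, below, above]
    rcases le_or_gt x a with hx | hx
    · simp [hx, hα x hx, show ¬k + 1 ≤ x by omega]
    rcases lt_or_ge k x with hx' | hx'
    · simp [hβ x hx', hx.not_ge, Nat.succ_le_iff.2 hx']
    · simp [hx.not_ge, show ¬k + 1 ≤ x by omega, sq_nonneg]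
  have hmean := h.mean_mono hpointwise
  rw [map_add, map_smul, map_smul, above_succ, map_sub, h.mean_const, mean_below hk,
    mean_below (hak.trans hk), smul_eq_mul, smul_eq_mul] at hmean
  calc ε * (α - β) ^ 2 / 2 ≤ (α - m) ^ 2 * ε + (β - m) ^ 2 * ε := by
        nlinarith [mul_nonneg hε (sq_nonneg (α - m + (β - m)))]
    _ ≤ (α - m) ^ 2 * cum w a + (β - m) ^ 2 * (1 - cum w k) := by
        gcongr
        linarith
    _ ≤ variance N w f := hmean

lemma passMean_sub_le (h : Rates N w u d) {r ε : ℝ} (hP : Poincare N w u r) (hr : 0 ≤ r)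
    (hε : 0 < ε) {a b : ℕ} (haN : a ≤ N) (hb : b ≤ N) (ha : ε ≤ cum w a)
    (hcum : ∀ j < b, cum w j ≤ 1 - ε) :
    passMean w u b - passMean w u a ≤ 2 * r / ε := by
  rcases le_or_gt b a with hba | hab
  · have := h.passMean_mono hba haN
    have : 0 ≤ 2 * r / ε := by positivity
    linarith
  have hs : Ico a b ⊆ range N := by grind
  set ρ := passMean w u b - passMean w u a
  have hsum : ρ = ∑ i ∈ Ico a b, edgeMean w u i := (sum_Ico_eq_sub _ hab.le).symm
  have hvar : ε * ρ ^ 2 / 2 ≤ variance N w (crossMean w u (Ico a b)) := by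
    rw [← sub_zero ρ]
    refine h.mul_sq_sub_le_variance hε.le (k := b - 1) (by omega) (by omega) (fun x hx => ?_)
      (fun x hx => ?_) ha (hcum _ (by omega))
    · rw [crossMean_apply, filter_true_of_mem (by grind), hsum]
    · rw [crossMean_apply, filter_false_of_mem (by grind), sum_empty]
  have hdir : dirichlet N w u (crossMean w u (Ico a b)) ≤ ρ := by
    rw [h.dirichlet_crossMean hs, hsum]
    refine sum_le_sum fun i hi => mul_le_of_le_one_right (h.edgeMean_pos (by grind)).le ?_
    exact h.cum_top ▸ h.cum_mono (by grind) le_rfl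
  have hρ₀ : 0 < ρ := hsum ▸ sum_pos (fun i hi => h.edgeMean_pos (by grind)) (nonempty_Ico.2 hab)
  rw [le_div_iff₀ hε]
  refine le_of_mul_le_mul_right ?_ hρ₀
  linarith [hP (crossMean w u (Ico a b)), mul_le_mul_of_nonneg_left hdir hr]

end Rates

/-! ### Monotonicity and unimodality -/

/-- `f` increases up to some point of `{0, …, N}` and decreases from there on. -/
def Unimodal (N : ℕ) (f : ℕ → ℝ) : Prop :=
  ∃ i ≤ N, MonotoneOn f (Set.Iic i) ∧ AntitoneOn f (Set.Icc i N)

lemma unimodal_of_forall {f : ℕ → ℝ} {i : ℕ} (hi : i ≤ N) (hinc : ∀ x < i, f x ≤ f (x + 1))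
    (hdec : ∀ x < N, i ≤ x → f (x + 1) ≤ f x) : Unimodal N f :=
  ⟨i, hi, monotoneOn_of_le_succ Set.ordConnected_Iic fun x _ _ hx => hinc x hx,
    antitoneOn_of_succ_le Set.ordConnected_Icc fun x _ hx hx' => hdec x hx'.2 hx.1⟩

lemma unimodal_single {x : ℕ} (hx : x ≤ N) : Unimodal N (Pi.single x 1) := by
  have hnonneg : ∀ y, (0 : ℝ) ≤ Pi.single (M := fun _ => ℝ) x 1 y := fun y => by
    rw [Pi.single_apply]; split_ifs <;> norm_num
  refine unimodal_of_forall hx (fun y hy => ?_) (fun y _ hy => ?_)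
  · rw [Pi.single_eq_of_ne hy.ne]
    exact hnonneg _
  · rw [Pi.single_eq_of_ne (by omega : y + 1 ≠ x)]
    exact hnonneg _

lemma Unimodal.ordConnected {f : ℕ → ℝ} (hf : Unimodal N f) (c : ℝ) :
    {y | y ≤ N ∧ c < f y}.OrdConnected := by
  obtain ⟨i, -, hinc, hdec⟩ := hf
  refine ⟨fun a ha b hb y hy => ⟨hy.2.trans hb.1, ?_⟩⟩
  rcases le_total y i with hyi | hyi
  · exact ha.2.trans_le (hinc (hy.1.trans hyi) hyi hy.1)
  · exact hb.2.trans_le (hdec ⟨hyi, hy.2.trans hb.1⟩ ⟨hyi.trans hy.2, hb.1⟩ hy.2)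

lemma antitone_below (k : ℕ) : Antitone (below k) := by
  intro x y hxy
  simp only [below]
  split_ifs <;> first | omega | norm_num

lemma below_nonneg (k x : ℕ) : 0 ≤ below k x := by
  simp only [below]
  split_ifs <;> norm_num

lemma below_le_one (k x : ℕ) : below k x ≤ 1 := by
  simp only [below]
  split_ifs <;> norm_num

lemma step_succ_sub_step (f : ℕ → ℝ) (x : ℕ) :
    step u d f (x + 1) - step u d f x = d x * (f x - f (x - 1)) +
      (1 - d (x + 1) - u x) * (f (x + 1) - f x) + u (x + 1) * (f (x + 2) - f (x + 1)) := by
  simp only [step_apply, Nat.add_sub_cancel]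
  ring

namespace Rates

lemma up_mul_nonneg (h : Rates N w u d) {x : ℕ} (hx : x ≤ N) {a : ℝ} (ha : x < N → 0 ≤ a) :
    0 ≤ u x * a := by
  rcases hx.lt_or_eq with hx' | rfl
  · exact mul_nonneg (h.u_nonneg hx) (ha hx')
  · simp [h.u_top]

lemma step_le_step_succ (h : Rates N w u d) {f : ℕ → ℝ} {x : ℕ} (hx : x < N)
    (h₀ : f (x - 1) ≤ f x) (h₁ : f x ≤ f (x + 1)) (h₂ : x + 1 < N → f (x + 1) ≤ f (x + 2)) :
    step u d f x ≤ step u d f (x + 1) := by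
  rw [← sub_nonneg, step_succ_sub_step]
  have hstay : 0 ≤ 1 - d (x + 1) - u x := by
    linarith [h.lazy x hx.le, h.lazy (x + 1) hx, h.d_nonneg hx.le, h.u_nonneg (x := x + 1) hx]
  exact add_nonneg (add_nonneg (mul_nonneg (h.d_nonneg hx.le) (sub_nonneg.2 h₀))
    (mul_nonneg hstay (sub_nonneg.2 h₁))) (h.up_mul_nonneg hx fun hx' => sub_nonneg.2 (h₂ hx'))

lemma step_succ_le_step (h : Rates N w u d) {f : ℕ → ℝ} {i x : ℕ}
    (hf : AntitoneOn f (Set.Icc i N)) (hix : i ≤ x - 1) (hx : x < N) :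
    step u d f (x + 1) ≤ step u d f x := by
  have hneg : ∀ y z, i ≤ y → y ≤ z → z ≤ N → (-f) y ≤ (-f) z := fun y z hiy hyz hz =>
    neg_le_neg (hf ⟨hiy, hyz.trans hz⟩ ⟨hiy.trans hyz, hz⟩ hyz)
  have hstep := h.step_le_step_succ hx (hneg _ x hix (by omega) hx.le)
    (hneg x (x + 1) (by omega) x.le_succ hx) fun hx' => hneg _ _ (by omega) (by omega) hx'
  rw [map_neg] at hstep
  exact neg_le_neg_iff.1 hstep

lemma pow_step_antitoneOn (h : Rates N w u d) (t : ℕ) {f : ℕ → ℝ}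
    (hf : AntitoneOn f (Set.Icc 0 N)) : AntitoneOn ((step u d ^ t) f) (Set.Icc 0 N) := by
  induction t generalizing f with
  | zero => exact hf
  | succ _ ih =>
    exact ih (antitoneOn_of_succ_le Set.ordConnected_Icc fun x _ _ hx =>
      h.step_succ_le_step hf (Nat.zero_le _) hx.2)

lemma pow_step_below_le (h : Rates N w u d) (t k : ℕ) {x y : ℕ} (hxy : x ≤ y) (hy : y ≤ N) :
    (step u d ^ t) (below k) y ≤ (step u d ^ t) (below k) x :=
  h.pow_step_antitoneOn t ((antitone_below k).antitoneOn _) ⟨x.zero_le, hxy.trans hy⟩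
    ⟨y.zero_le, hy⟩ hxy

/-- By laziness, the peak keeps its lead over the neighbour with the larger drop: in one step it
loses at most half of that drop to the other neighbour. -/
lemma step_le_or_step_le (h : Rates N w u d) {f : ℕ → ℝ} {i : ℕ} (hi : i + 1 < N)
    (hinc : MonotoneOn f (Set.Iic (i + 1))) (hdec : AntitoneOn f (Set.Icc (i + 1) N)) :
    step u d f i ≤ step u d f (i + 1) ∨ step u d f (i + 2) ≤ step u d f (i + 1) := by
  have hleft : 0 ≤ d i * (f i - f (i - 1)) := mul_nonneg (h.d_nonneg (by omega))
    (sub_nonneg.2 (hinc (by grind) (by grind) (i.sub_le 1)))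
  have hright : 0 ≤ u (i + 2) * (f (i + 2) - f (i + 3)) := h.up_mul_nonneg hi fun hi' =>
    sub_nonneg.2 (hdec ⟨by omega, hi⟩ ⟨by omega, hi'⟩ (by omega))
  set a := f (i + 1) - f i with ha
  set b := f (i + 1) - f (i + 2) with hb
  have ha₀ : 0 ≤ a := sub_nonneg.2 (hinc (by grind) (by grind) i.le_succ)
  have hb₀ : 0 ≤ b := sub_nonneg.2 (hdec ⟨le_rfl, hi.le⟩ ⟨by omega, hi⟩ (by omega))
  have hlazy₀ := h.lazy i (by omega)
  have hlazy₁ := h.lazy (i + 1) hi.le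
  have hlazy₂ := h.lazy (i + 2) hi
  have hd₀ := h.d_nonneg (x := i) (by omega)
  have hu₂ := h.u_nonneg (x := i + 2) hi
  rcases le_total b a with hab | hab
  · left
    rw [← sub_nonneg, step_succ_sub_step, ← ha, ← neg_sub (f (i + 1)) (f (i + 2)), ← hb]
    have hpeak : u (i + 1) * b ≤ (1 - d (i + 1) - u i) * a :=
      mul_le_mul (by linarith) hab hb₀ (by linarith [h.u_nonneg hi.le])
    linarith
  · right
    rw [← sub_nonpos, step_succ_sub_step, Nat.add_sub_cancel, ← ha,
      ← neg_sub (f (i + 1)) (f (i + 2)), ← hb]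
    have hpeak : d (i + 1) * a ≤ (1 - d (i + 2) - u (i + 1)) * b :=
      mul_le_mul (by linarith) hab ha₀ (by linarith [h.d_nonneg hi.le])
    simp only [add_assoc, Nat.reduceAdd]
    linarith

lemma step_unimodal (h : Rates N w u d) {f : ℕ → ℝ} (hf : Unimodal N f) :
    Unimodal N (step u d f) := by
  obtain ⟨i, hi, hinc, hdec⟩ := hf
  have hinc' : ∀ x, x + 1 < i → step u d f x ≤ step u d f (x + 1) := fun x hx =>
    h.step_le_step_succ (by omega) (hinc (by grind) (by grind) (by omega))
      (hinc (by grind) (by grind) (by omega)) fun _ => hinc (by grind) (by grind) (by omega)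
  have hdec' : ∀ x < N, i < x → step u d f (x + 1) ≤ step u d f x := fun x hx hix =>
    h.step_succ_le_step hdec (by omega) hx
  rcases i with _ | i
  · by_cases hpeak : 0 < N ∧ step u d f 0 < step u d f 1
    · exact unimodal_of_forall (i := 1) hpeak.1 (by grind) (by grind)
    · exact unimodal_of_forall (i := 0) hi (by grind) (by grind)
  by_cases hup : i + 1 < N ∧ step u d f (i + 1) < step u d f (i + 2)
  · have := (h.step_le_or_step_le hup.1 hinc hdec).resolve_right hup.2.not_ge
    exact unimodal_of_forall (i := i + 2) hup.1 (by grind) (by grind)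
  by_cases hdown : step u d f (i + 1) < step u d f i
  · exact unimodal_of_forall (i := i) (by omega) (by grind) (by grind)
  · exact unimodal_of_forall (i := i + 1) hi (by grind) (by grind)

lemma pow_step_unimodal (h : Rates N w u d) (t : ℕ) {f : ℕ → ℝ} (hf : Unimodal N f) :
    Unimodal N ((step u d ^ t) f) := by
  induction t generalizing f with
  | zero => exact hf
  | succ _ ih => exact ih (h.step_unimodal hf)

end Rates

/-! ### Discrepancies of segments -/

/-- The difference between the mean of a function under the law at time `t` of the chain started
at `x` and its stationary mean. -/
noncomputable def discrepancy (N : ℕ) (w u d : ℕ → ℝ) (t x : ℕ) : (ℕ → ℝ) →ₗ[ℝ] ℝ :=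
  LinearMap.proj x ∘ₗ (step u d ^ t) - mean N w

lemma discrepancy_apply (N : ℕ) (w u d : ℕ → ℝ) (t x : ℕ) (f : ℕ → ℝ) :
    discrepancy N w u d t x f = (step u d ^ t) f x - mean N w f := rfl

lemma sum_single_Icc {a b : ℕ} (hab : a ≤ b) :
    ∑ y ∈ Icc a b, (Pi.single y 1 : ℕ → ℝ) = below b + above a - fun _ => 1 := by
  ext z
  simp only [Finset.sum_apply, Pi.single_apply, sum_ite_eq, mem_Icc, Pi.add_apply, Pi.sub_apply,
    below, above]
  split_ifs <;> first | omega | norm_num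

namespace Rates

lemma discrepancy_const (h : Rates N w u d) (t x : ℕ) (a : ℝ) :
    discrepancy N w u d t x (fun _ => a) = 0 := by
  rw [discrepancy_apply, pow_step_const, h.mean_const, sub_self]

lemma discrepancy_reflect (h : Rates N w u d) (t : ℕ) (f : ℕ → ℝ) {x : ℕ} (hx : x ≤ N) :
    discrepancy N w u d t x (reflect N f) =
      discrepancy N (reflect N w) (reflect N d) (reflect N u) t (N - x) f := by
  rw [discrepancy_apply, discrepancy_apply, ← mean_reflect,
    ← reflect_reflect (f := (step u d ^ t) _) hx, reflect, ← h.pow_step_reflect t _ _ (N.sub_le x),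
    h.reflect.pow_step_congr t (fun y hy => reflect_reflect hy) _ (N.sub_le x)]

lemma discrepancy_below_le_zero_left (h : Rates N w u d) (t k : ℕ) {x : ℕ} (hx : x ≤ N) :
    discrepancy N w u d t x (below k) ≤ discrepancy N w u d t 0 (below k) :=
  sub_le_sub_right (h.pow_step_below_le t k x.zero_le hx) _

lemma discrepancy_below_self (h : Rates N w u d) (t : ℕ) :
    discrepancy N w u d t 0 (below N) = 0 := by
  rw [discrepancy_apply, mean_below le_rfl, h.cum_top,
    h.pow_step_congr t (f := below N) (g := fun _ => 1) (fun x hx => if_pos hx) 0 N.zero_le,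
    pow_step_const, sub_self]

lemma eq_empty_or_eq_Icc (h : Rates N w u d) (t : ℕ) {x : ℕ} (hx : x ≤ N) :
    {y ∈ range (N + 1) | w y < (step u d ^ t) (Pi.single y 1) x} = ∅ ∨ ∃ a b, a ≤ b ∧ b ≤ N ∧
      {y ∈ range (N + 1) | w y < (step u d ^ t) (Pi.single y 1) x} = Icc a b := by
  set S := {y ∈ range (N + 1) | w y < (step u d ^ t) (Pi.single y 1) x} with hS
  have hmem : ∀ y, y ∈ S ↔ y ≤ N ∧ w x < (step u d ^ t) (Pi.single x 1) y := by
    intro y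
    rw [hS, mem_filter, mem_range, Nat.lt_succ_iff]
    refine and_congr_right fun hy => ?_
    rw [← mul_lt_mul_iff_right₀ (h.w_pos x hx), h.pow_step_single_balance t hx hy, mul_comm (w x),
      mul_lt_mul_iff_right₀ (h.w_pos y hy)]
  refine S.eq_empty_or_nonempty.imp_right fun hne => ?_
  have hmin := (hmem _).1 (S.min'_mem hne)
  have hmax := (hmem _).1 (S.max'_mem hne)
  refine ⟨S.min' hne, S.max' hne, S.min'_le_max' hne, hmax.1, ?_⟩
  ext y
  rw [mem_Icc]
  exact ⟨fun hy => ⟨S.min'_le _ hy, S.le_max' _ hy⟩, fun hy => (hmem y).2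
    (((h.pow_step_unimodal t (unimodal_single hx)).ordConnected (w x)).out hmin hmax hy)⟩

lemma sum_max_sub_le (h : Rates N w u d) {t : ℕ} {A B : ℝ}
    (hA : ∀ k ≤ N, discrepancy N w u d t 0 (below k) ≤ A)
    (hB : ∀ k ≤ N,
      discrepancy N (reflect N w) (reflect N d) (reflect N u) t 0 (below k) ≤ B)
    {x : ℕ} (hx : x ≤ N) :
    ∑ y ∈ range (N + 1), max 0 ((step u d ^ t) (Pi.single y 1) x - w y) ≤ A + B := by
  set S := {y ∈ range (N + 1) | w y < (step u d ^ t) (Pi.single y 1) x} with hS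
  have hsum : ∑ y ∈ range (N + 1), max 0 ((step u d ^ t) (Pi.single y 1) x - w y) =
      ∑ y ∈ S, discrepancy N w u d t x (Pi.single y 1) := by
    rw [hS, sum_filter]
    refine sum_congr rfl fun y hy => ?_
    rw [discrepancy_apply, mean_single (by grind)]
    split_ifs with hlt
    · exact max_eq_right (sub_nonneg.2 hlt.le)
    · exact max_eq_left (sub_nonpos.2 (not_lt.1 hlt))
  rw [hsum]
  rcases h.eq_empty_or_eq_Icc t hx with hempty | ⟨a, b, hab, hbN, hIcc⟩
  · rw [hS, hempty, sum_empty]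
    linarith [hA N le_rfl, hB N le_rfl, h.discrepancy_below_self t,
      h.reflect.discrepancy_below_self t]
  · rw [hS, hIcc, ← map_sum, sum_single_Icc hab, map_sub, map_add, h.discrepancy_const, sub_zero,
      ← reflect_below (hab.trans hbN), h.discrepancy_reflect t _ hx]
    exact add_le_add ((h.discrepancy_below_le_zero_left t b hx).trans (hA b hbN))
      ((h.reflect.discrepancy_below_le_zero_left t _ (N.sub_le x)).trans (hB _ (N.sub_le a)))

end Rates

/-! ### Passage times and the distance to stationarity -/

protected lemma Poincare.reflect {r : ℝ} (hP : Poincare N w u r) (h : Rates N w u d) :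
    Poincare N (reflect N w) (reflect N d) r := by
  intro f
  have hdirichlet : dirichlet N (reflect N w) (reflect N d) f = dirichlet N w u (reflect N f) := by
    rw [dirichlet, dirichlet, ← sum_range_reflect]
    refine sum_congr rfl fun j hj => ?_
    rw [mem_range] at hj
    simp only [reflect]
    rw [show N - (N - 1 - j) = j + 1 by omega, show N - 1 - j + 1 = N - j by omega,
      show N - (j + 1) = N - 1 - j by omega, ← h.balance j hj]
    ring
  rw [variance_reflect, hdirichlet]
  exact hP _

namespace Rates

lemma exists_quantile (h : Rates N w u d) {α : ℝ} (hα : α ≤ 1) :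
    ∃ l ≤ N, α ≤ cum w l ∧ ∀ j < l, cum w j < α := by
  have hN : α ≤ cum w N := h.cum_top ▸ hα
  have hex : ∃ l, α ≤ cum w l := ⟨N, hN⟩
  classical
  exact ⟨Nat.find hex, Nat.find_min' hex hN, Nat.find_spec hex,
    fun j hj => not_le.1 (Nat.find_min hex hj)⟩

lemma passVar_le_mul_sq (h : Rates N w u d) {r ε : ℝ} (hP : Poincare N w u r) (hε : 0 < ε)
    {l : ℕ} (hl : l ≤ N) (hcum : ∀ j < l, cum w j ≤ 1 - ε) {s : ℝ}
    (hs : √(2 * passMean w u l * r) / ε < |s|) : passVar w u l ≤ ε * s ^ 2 := by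
  rw [div_lt_iff₀ hε] at hs
  calc passVar w u l ≤ 2 * r / ε * passMean w u l := h.passVar_le hP hε hl hcum
    _ = 2 * passMean w u l * r / ε := by ring
    _ ≤ (|s| * ε) ^ 2 / ε := by gcongr; exact (Real.lt_sq_of_sqrt_lt hs).le
    _ = ε * s ^ 2 := by rw [mul_pow, sq_abs]; field_simp

lemma pow_step_below_le_div (h : Rates N w u d) (t : ℕ) {k l : ℕ} (hk : k ≤ N) (hl : l ≤ N) :
    (step u d ^ t) (below k) l ≤ cum w k / cum w l := by
  set v := (step u d ^ t) (below k) l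
  have hle : ∀ x ≤ N, (v • below l) x ≤ (step u d ^ t) (below k) x := by
    intro x hx
    rw [Pi.smul_apply, smul_eq_mul, below]
    split_ifs with hxl
    · rw [mul_one]
      exact h.pow_step_below_le t k hxl hl
    · rw [mul_zero]
      exact h.le_pow_step t (fun y _ => below_nonneg k y) x hx
  have hmean := h.mean_mono hle
  rw [map_smul, h.mean_pow_step, mean_below hk, mean_below hl] at hmean
  exact (le_div_iff₀ (h.cum_pos hl)).2 hmean

lemma discrepancy_below_le_of_lt (h : Rates N w u d) {r ε : ℝ} (hP : Poincare N w u r)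
    (hε : 0 < ε) {l : ℕ} (hl : l ≤ N) (hcuml : 1 - ε ≤ cum w l)
    (hcum : ∀ j < l, cum w j ≤ 1 - ε) {t : ℕ}
    (ht : passMean w u l + √(2 * passMean w u l * r) / ε < t) {k : ℕ} (hk : k ≤ N) :
    discrepancy N w u d t 0 (below k) ≤ 2 * ε := by
  rw [discrepancy_apply, mean_below hk]
  rcases le_or_gt (1 - ε) (cum w k) with hcumk | hcumk
  · linarith [h.pow_step_le t (fun x _ => below_le_one k x) 0 N.zero_le]
  have hsqrt : 0 ≤ √(2 * passMean w u l * r) / ε := by positivity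
  have hτ : 0 < t - passMean w u l := by linarith
  have hdiv : cum w k / cum w l ≤ cum w k + ε := by
    rw [div_le_iff₀ (h.cum_pos hl)]
    nlinarith [h.cum_pos hk]
  have hpass := (h.pow_step_sub_mul_sq_le_passVar hl (fun x _ => below_le_one k x)
    (div_pos (h.cum_pos hk) (h.cum_pos hl)).le (fun s => h.pow_step_below_le_div s hk hl)
    (by linarith)).trans (h.passVar_le_mul_sq hP hε hl hcum ((lt_sub_iff_add_lt'.2 ht).trans_le
      (le_abs_self _)))
  linarith [le_of_mul_le_mul_right hpass (pow_pos hτ 2)]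

lemma pow_step_above_le_of_lt (h : Rates N w u d) {r ε : ℝ} (hP : Poincare N w u r)
    (hε : 0 < ε) {l : ℕ} (hl : l ≤ N) (hcum : ∀ j < l, cum w j ≤ 1 - ε) {t : ℕ}
    (ht : t < passMean w u l - √(2 * passMean w u l * r) / ε) :
    (step u d ^ t) (above l) 0 ≤ ε := by
  have hsqrt : 0 ≤ √(2 * passMean w u l * r) / ε := by positivity
  have hτ : t - passMean w u l < 0 := by linarith
  have hpass := (h.pow_step_mul_sq_le_passVar hl (f := above l)
    (fun x _ => by rw [above]; split_ifs <;> norm_num) (fun x hx => if_neg hx.not_ge)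
    (by linarith)).trans (h.passVar_le_mul_sq hP hε hl hcum
      (by rw [abs_of_neg hτ]; linarith))
  exact le_of_mul_le_mul_right hpass (sq_pos_of_neg hτ)

lemma exists_passage_bounds (h : Rates N w u d) {r ε : ℝ} (hP : Poincare N w u r) (hr : 0 ≤ r)
    (hε : 0 < ε) (hε₂ : ε ≤ 1 / 2) :
    ∃ A B : ℝ, 0 ≤ B ∧ B ≤ A ∧ A - B ≤ 2 * r / ε ∧
      (∀ t : ℕ, A + √(2 * A * r) / ε < t →
        ∀ k ≤ N, discrepancy N w u d t 0 (below k) ≤ 2 * ε) ∧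
      ∀ t : ℕ, t < B - √(2 * B * r) / ε →
        ∃ k ≤ N, 1 - 2 * ε < discrepancy N w u d t 0 (below k) := by
  obtain ⟨a, haN, ha, ha'⟩ := h.exists_quantile (α := ε) (by linarith)
  obtain ⟨b, hbN, hb, hb'⟩ := h.exists_quantile (α := 1 - ε) (by linarith)
  have hab : a ≤ b := by
    by_contra! hlt
    linarith [ha' b hlt]
  refine ⟨passMean w u b, passMean w u a, h.passMean_mono a.zero_le haN, h.passMean_mono hab hbN,
    h.passMean_sub_le hP hr hε haN hbN ha fun j hj => (hb' j hj).le,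
    fun t ht k hk => h.discrepancy_below_le_of_lt hP hε hbN hb (fun j hj => (hb' j hj).le) ht hk,
    fun t ht => ?_⟩
  rcases a with _ | k
  · simp only [passMean, range_zero, sum_empty, mul_zero, zero_mul, Real.sqrt_zero, zero_div,
      sub_zero] at ht
    linarith [t.cast_nonneg (α := ℝ)]
  · refine ⟨k, by omega, ?_⟩
    have hearly := h.pow_step_above_le_of_lt hP hε haN
      (fun j hj => by linarith [ha' j hj]) ht
    rw [above_succ, map_sub, pow_step_const, Pi.sub_apply] at hearly
    rw [discrepancy_apply, mean_below (by omega)]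
    linarith [ha' k k.lt_succ_self]

end Rates

/-! ### Total variation -/

open scoped Matrix

section Markov

variable {Ω : Type*} [Fintype Ω]

lemma tv_nonneg (μ ν : Ω → ℝ) : 0 ≤ tv μ ν :=
  mul_nonneg (by norm_num) (sum_nonneg fun _ _ => abs_nonneg _)

lemma tv_eq_sum_max_sub {μ ν : Ω → ℝ} (h : ∑ x, μ x = ∑ x, ν x) :
    tv μ ν = ∑ x, max 0 (μ x - ν x) := by
  have habs : ∀ a : ℝ, |a| = 2 * max 0 a - a := fun a => by
    rw [max_comm, ← posPart_def]
    linarith [posPart_add_negPart a, posPart_sub_negPart a]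
  simp only [tv, habs, sum_sub_distrib, ← mul_sum, h]
  ring

lemma dotProduct_sub_le_tv {μ ν f : Ω → ℝ} (h : ∑ x, μ x = ∑ x, ν x) (hf₀ : ∀ x, 0 ≤ f x)
    (hf₁ : ∀ x, f x ≤ 1) : μ ⬝ᵥ f - ν ⬝ᵥ f ≤ tv μ ν := by
  rw [tv_eq_sum_max_sub h, ← sub_dotProduct]
  refine sum_le_sum fun x _ => ?_
  calc (μ - ν) x * f x ≤ max 0 (μ x - ν x) * f x :=
        mul_le_mul_of_nonneg_right (le_max_right _ _) (hf₀ x)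
    _ ≤ max 0 (μ x - ν x) := mul_le_of_le_one_right (le_max_left _ _) (hf₁ x)

lemma abs_dotProduct_sub_le_tv {μ ν f : Ω → ℝ} {a : ℝ} (hf : ∀ x, |f x| ≤ a) :
    |μ ⬝ᵥ f - ν ⬝ᵥ f| ≤ 2 * tv μ ν * a := by
  rw [← sub_dotProduct, tv, ← mul_assoc, mul_one_div_cancel two_ne_zero, one_mul, sum_mul]
  refine (abs_sum_le_sum_abs _ _).trans (sum_le_sum fun x _ => ?_)
  rw [abs_mul]
  exact mul_le_mul_of_nonneg_left (hf x) (abs_nonneg _)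

variable {P : Matrix Ω Ω ℝ} {p : Ω → ℝ}

namespace IsStationary

lemma vecMul_pow [DecidableEq Ω] (hp : IsStationary P p) (t : ℕ) : p ᵥ* P ^ t = p := by
  induction t with
  | zero => rw [pow_zero, Matrix.vecMul_one]
  | succ t ih => rw [pow_succ, ← Matrix.vecMul_vecMul, ih, hp.2]

lemma pos (hp : IsStationary P p) (hirr : P.IsIrreducible) (x : Ω) : 0 < p x := by
  classical
  obtain ⟨y, -, hy⟩ : ∃ y ∈ univ, 0 < p y :=
    exists_lt_of_sum_lt (by simpa only [sum_const_zero, hp.1.2] using one_pos)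
  obtain ⟨k, -, hk⟩ := (Matrix.isIrreducible_iff_exists_pow_pos hirr.nonneg).1 hirr y x
  rw [← hp.vecMul_pow k]
  exact (mul_pos hy hk).trans_le (single_le_sum (f := fun z => p z * (P ^ k) z x) (fun z _ =>
    mul_nonneg (hp.1.1 z) (Matrix.pow_apply_nonneg hirr.nonneg k z x)) (mem_univ y))

end IsStationary

variable [DecidableEq Ω]

lemma tv_le_worstDist (P : Matrix Ω Ω ℝ) (p : Ω → ℝ) (t : ℕ) (x : Ω) :
    tv ((P ^ t) x) p ≤ worstDist P p t :=
  le_ciSup (f := fun x => tv ((P ^ t) x) p) (Set.finite_range _).bddAbove x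

lemma tmix_le {ε : ℝ} {t : ℕ} (h : worstDist P p t ≤ ε) : tmix P p ε ≤ t := Nat.sInf_le h

namespace IsStationary

lemma sum_pow_row (hp : IsStationary P p) (hP : P ∈ Matrix.rowStochastic ℝ Ω) (t : ℕ) (x : Ω) :
    ∑ y, (P ^ t) x y = ∑ y, p y := by
  rw [hp.1.2, Matrix.sum_row_of_mem_rowStochastic (pow_mem hP t)]

lemma pow_mulVec_sub_le_worstDist (hp : IsStationary P p) (hP : P ∈ Matrix.rowStochastic ℝ Ω)
    (t : ℕ) {f : Ω → ℝ} (hf₀ : ∀ x, 0 ≤ f x) (hf₁ : ∀ x, f x ≤ 1) (x : Ω) :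
    (P ^ t *ᵥ f) x - p ⬝ᵥ f ≤ worstDist P p t :=
  (dotProduct_sub_le_tv (hp.sum_pow_row hP t x) hf₀ hf₁).trans (tv_le_worstDist P p t x)

lemma half_pow_sub_le_worstDist (hp : IsStationary P p) (hP : P ∈ Matrix.rowStochastic ℝ Ω)
    (hlazy : IsLazy P) (t : ℕ) (x : Ω) : (1 / 2) ^ t - p x ≤ worstDist P p t := by
  have hstay : (1 / 2 : ℝ) ^ t ≤ (P ^ t) x x := by
    induction t with
    | zero => simp
    | succ t ih =>
      rw [pow_succ, pow_succ, Matrix.mul_apply]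
      refine (mul_le_mul ih (hlazy x) (by norm_num) (le_trans (by positivity) ih)).trans ?_
      exact single_le_sum (f := fun z => (P ^ t) x z * P z x)
        (fun z _ => mul_nonneg ((pow_mem hP t).1 x z) (hP.1 z x)) (mem_univ x)
  have hdist := hp.pow_mulVec_sub_le_worstDist hP t (f := Pi.single x 1)
    (fun y => by rw [Pi.single_apply]; split_ifs <;> norm_num)
    (fun y => by rw [Pi.single_apply]; split_ifs <;> norm_num) x
  rw [Matrix.mulVec_single_one, dotProduct_single_one, Matrix.col_apply] at hdist
  linarith

lemma tv_pow_zero (hp : IsStationary P p) (x : Ω) : tv ((P ^ 0) x) p = 1 - p x := by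
  have hsum : ∑ y, (P ^ 0) x y = ∑ y, p y := by simp [Matrix.one_apply, hp.1.2]
  have hle : p x ≤ 1 := hp.1.2 ▸ single_le_sum (fun y _ => hp.1.1 y) (mem_univ x)
  rw [tv_eq_sum_max_sub hsum, sum_eq_single_of_mem x (mem_univ x), pow_zero, Matrix.one_apply_eq,
    max_eq_right (sub_nonneg.2 hle)]
  intro y _ hy
  rw [pow_zero, Matrix.one_apply_ne hy.symm, zero_sub, max_eq_left (neg_nonpos.2 (hp.1.1 y))]

lemma exists_worstDist_zero_eq [Nonempty Ω] (hp : IsStationary P p) :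
    ∃ x, worstDist P p 0 = 1 - p x := by
  obtain ⟨x, hx⟩ := exists_eq_ciSup_of_finite (f := fun x => tv ((P ^ 0) x) p)
  exact ⟨x, hx.symm.trans (hp.tv_pow_zero x)⟩

lemma half_le_worstDist_zero [Nontrivial Ω] (hp : IsStationary P p) :
    1 / 2 ≤ worstDist P p 0 := by
  obtain ⟨x, y, hxy⟩ := exists_pair_ne Ω
  have hle : p x + p y ≤ 1 := by
    rw [← hp.1.2, ← sum_pair hxy]
    exact sum_le_sum_of_subset_of_nonneg (subset_univ _) fun z _ _ => hp.1.1 z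
  linarith [hp.tv_pow_zero x, hp.tv_pow_zero y, tv_le_worstDist P p 0 x, tv_le_worstDist P p 0 y]

end IsStationary

/-! ### The spectral gap -/

lemma pow_mulVec_eq_smul {f : Ω → ℝ} {μ : ℝ} (hf : P *ᵥ f = μ • f) (t : ℕ) :
    P ^ t *ᵥ f = μ ^ t • f := by
  induction t with
  | zero => rw [pow_zero, pow_zero, Matrix.one_mulVec, one_smul]
  | succ t ih =>
    rw [pow_succ, ← Matrix.mulVec_mulVec, hf, Matrix.mulVec_smul, ih, smul_smul, pow_succ']

lemma eigenvalue_mem_Icc (hP : P ∈ Matrix.rowStochastic ℝ Ω) (hlazy : IsLazy P) {μ : ℝ}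
    (hμ : Module.End.HasEigenvalue (Matrix.toLin' P) μ) : μ ∈ Set.Icc (0 : ℝ) 1 := by
  obtain ⟨x, hx⟩ := eigenvalue_mem_ball hμ
  have hrow := Matrix.sum_row_of_mem_rowStochastic hP x
  rw [← add_sum_erase _ _ (mem_univ x)] at hrow
  simp only [Real.norm_of_nonneg (hP.1 x _), Metric.mem_closedBall, Real.dist_eq] at hx
  have hμ := abs_le.1 hx
  constructor <;> linarith [hlazy x]

lemma lam_nonneg (P : Matrix Ω Ω ℝ) : 0 ≤ lam P :=
  Real.sSup_nonneg fun _ ⟨μ, _, _, hr⟩ => hr ▸ abs_nonneg μ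

lemma gap_le_one (P : Matrix Ω Ω ℝ) : gap P ≤ 1 := sub_le_self 1 (lam_nonneg P)

lemma finite_abs_nontrivial_eigenvalues (P : Matrix Ω Ω ℝ) :
    {r | ∃ μ : ℝ, Module.End.HasEigenvalue (Matrix.toLin' P) μ ∧ μ ≠ 1 ∧ r = |μ|}.Finite :=
  ((Module.End.finite_hasEigenvalue (Matrix.toLin' P)).image fun μ => |μ|).subset
    fun _ ⟨μ, hμ, _, hr⟩ => ⟨μ, hμ, hr.symm⟩

lemma abs_le_lam {μ : ℝ} (hμ : Module.End.HasEigenvalue (Matrix.toLin' P) μ) (hμ₁ : μ ≠ 1) :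
    |μ| ≤ lam P :=
  le_csSup (finite_abs_nontrivial_eigenvalues P).bddAbove ⟨μ, hμ, hμ₁, rfl⟩

lemma lam_eq_zero_or_exists (P : Matrix Ω Ω ℝ) : lam P = 0 ∨
    ∃ μ : ℝ, Module.End.HasEigenvalue (Matrix.toLin' P) μ ∧ μ ≠ 1 ∧ lam P = |μ| := by
  rcases Set.eq_empty_or_nonempty
    {r | ∃ μ : ℝ, Module.End.HasEigenvalue (Matrix.toLin' P) μ ∧ μ ≠ 1 ∧ r = |μ|} with h | h
  · exact .inl (by rw [lam, h, Real.sSup_empty])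
  · exact .inr (h.csSup_mem (finite_abs_nontrivial_eigenvalues P))

lemma gap_pos (hP : P ∈ Matrix.rowStochastic ℝ Ω) (hlazy : IsLazy P) : 0 < gap P := by
  rw [gap, sub_pos]
  rcases lam_eq_zero_or_exists P with h | ⟨μ, hμ, hμ₁, h⟩
  · exact h ▸ one_pos
  · have hmem := eigenvalue_mem_Icc hP hlazy hμ
    rw [h, abs_of_nonneg hmem.1]
    exact hmem.2.lt_of_ne hμ₁

lemma IsStationary.lam_pow_le [Nonempty Ω] (hp : IsStationary P p) {t : ℕ} (ht : t ≠ 0) :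
    lam P ^ t ≤ 2 * worstDist P p t := by
  obtain ⟨x₀⟩ := ‹Nonempty Ω›
  rcases lam_eq_zero_or_exists P with h | ⟨μ, hμ, hμ₁, h⟩
  · rw [h, zero_pow ht]
    linarith [tv_nonneg ((P ^ t) x₀) p, tv_le_worstDist P p t x₀]
  obtain ⟨f, hf⟩ := hμ.exists_hasEigenvector
  have hPf : P *ᵥ f = μ • f := by simpa using hf.apply_eq_smul
  have hpf : p ⬝ᵥ f = 0 := by
    have hfix : μ * (p ⬝ᵥ f) = p ⬝ᵥ f := by
      rw [← smul_eq_mul, ← dotProduct_smul, ← hPf, Matrix.dotProduct_mulVec, hp.2]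
    by_contra h
    exact hμ₁ (mul_right_cancel₀ h (hfix.trans (one_mul _).symm))
  obtain ⟨x, hx⟩ := Finite.exists_max fun y => |f y|
  obtain ⟨z, hz⟩ := Function.ne_iff.1 hf.2
  have hfx : 0 < |f x| := (abs_pos.2 hz).trans_le (hx z)
  have hdecay : |(P ^ t) x ⬝ᵥ f - p ⬝ᵥ f| = |μ| ^ t * |f x| := by
    rw [hpf, sub_zero, ← abs_pow, ← abs_mul]
    exact congrArg abs (congrFun (pow_mulVec_eq_smul hPf t) x)
  have htv := abs_dotProduct_sub_le_tv (μ := (P ^ t) x) (ν := p) hx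
  rw [hdecay] at htv
  rw [h]
  linarith [le_of_mul_le_mul_right htv hfx, tv_le_worstDist P p t x]

end Markov

/-! ### The Poincaré inequality of a reversible chain -/

section Reversible

variable {Ω : Type*} [Fintype Ω] {P : Matrix Ω Ω ℝ} {p : Ω → ℝ}

/-- Reversibility of the kernel `P` with respect to the weights `p`. -/
def IsReversible (P : Matrix Ω Ω ℝ) (p : Ω → ℝ) : Prop := ∀ x y, p x * P x y = p y * P y x

lemma dotProduct_mulVec_le_of_isHermitian {A : Matrix Ω Ω ℝ} (hA : A.IsHermitian) {c : ℝ}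
    {v : Ω → ℝ} (hv : ∀ μ z, c < μ → A *ᵥ z = μ • z → z ⬝ᵥ v = 0) :
    v ⬝ᵥ A *ᵥ v ≤ c * (v ⬝ᵥ v) := by
  classical
  set b := hA.eigenvectorBasis
  have hb : ∀ i, A *ᵥ (b i).ofLp = hA.eigenvalues i • (b i).ofLp := hA.mulVec_eigenvectorBasis
  have hparseval : ∀ z : Ω → ℝ, v ⬝ᵥ z = ∑ i, ((b i).ofLp ⬝ᵥ v) * ((b i).ofLp ⬝ᵥ z) := by
    intro z
    have := b.sum_inner_mul_inner (WithLp.toLp 2 v) (WithLp.toLp 2 z)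
    simp only [EuclideanSpace.inner_eq_star_dotProduct, star_trivial] at this
    rw [dotProduct_comm v z, ← this]
    exact sum_congr rfl fun i _ => by rw [dotProduct_comm z]
  have hAb : ∀ i, (b i).ofLp ⬝ᵥ A *ᵥ v = hA.eigenvalues i * ((b i).ofLp ⬝ᵥ v) := by
    intro i
    rw [Matrix.dotProduct_mulVec, ← Matrix.mulVec_transpose,
      ← Matrix.conjTranspose_eq_transpose_of_trivial, hA.eq, hb, smul_dotProduct, smul_eq_mul]
  rw [hparseval, hparseval, mul_sum]
  refine sum_le_sum fun i _ => ?_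
  rw [hAb, mul_left_comm]
  rcases le_or_gt (hA.eigenvalues i) c with hc | hc
  · exact mul_le_mul_of_nonneg_right hc (mul_self_nonneg _)
  · simp [hv _ _ hc (hb i)]

variable [DecidableEq Ω]

lemma eq_of_mulVec_eq_self (hP : P ∈ Matrix.rowStochastic ℝ Ω) (hirr : P.IsIrreducible)
    {g : Ω → ℝ} (hg : P *ᵥ g = g) (x y : Ω) : g x = g y := by
  have : Nonempty Ω := ⟨x⟩
  obtain ⟨m, hm⟩ := Finite.exists_max g
  suffices hmax : ∀ z, g z = g m from (hmax x).trans (hmax y).symm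
  intro z
  obtain ⟨k, -, hk⟩ := (Matrix.isIrreducible_iff_exists_pow_pos hirr.nonneg).1 hirr m z
  have hfix : ∑ y, (P ^ k) m y * g y = g m :=
    congrFun ((pow_mulVec_eq_smul (by rw [hg, one_smul]) k).trans (by rw [one_pow, one_smul])) m
  have hsum : ∑ y, (P ^ k) m y * (g m - g y) = 0 := by
    simp only [mul_sub, sum_sub_distrib, ← sum_mul, hfix,
      Matrix.sum_row_of_mem_rowStochastic (pow_mem hP k), one_mul, sub_self]
  have hz := (sum_eq_zero_iff_of_nonneg fun y _ =>
    mul_nonneg ((pow_mem hP k).1 m y) (sub_nonneg.2 (hm y))).1 hsum z (mem_univ z)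
  linarith [(mul_eq_zero.1 hz).resolve_left hk.ne']

lemma sum_mul_eq_zero_of_lam_lt (hP : P ∈ Matrix.rowStochastic ℝ Ω) (hirr : P.IsIrreducible)
    {f g : Ω → ℝ} (hf : p ⬝ᵥ f = 0) {μ : ℝ} (hμ : lam P < μ) (hg : P *ᵥ g = μ • g) :
    ∑ x, p x * (g x * f x) = 0 := by
  by_cases hg₀ : g = 0
  · simp [hg₀]
  have heig : Module.End.HasEigenvalue (Matrix.toLin' P) μ :=
    Module.End.hasEigenvalue_of_hasEigenvector
      ⟨Module.End.mem_eigenspace_iff.2 ((Matrix.toLin'_apply P g).trans hg), hg₀⟩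
  have hμ₁ : μ = 1 := by
    by_contra hne
    exact hμ.not_ge ((le_abs_self μ).trans (abs_le_lam heig hne))
  obtain ⟨x₀, -⟩ := Function.ne_iff.1 hg₀
  have hconst := eq_of_mulVec_eq_self hP hirr (hg.trans (by rw [hμ₁, one_smul])) x₀
  calc ∑ x, p x * (g x * f x) = ∑ x, g x₀ * (p x * f x) :=
        sum_congr rfl fun x _ => by rw [hconst x, mul_left_comm]
    _ = g x₀ * (p ⬝ᵥ f) := (mul_sum _ _ _).symm
    _ = 0 := by rw [hf, mul_zero]

lemma IsReversible.gap_mul_le (hrev : IsReversible P p) (hp : ∀ x, 0 < p x)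
    (hP : P ∈ Matrix.rowStochastic ℝ Ω) (hirr : P.IsIrreducible) {f : Ω → ℝ} (hf : p ⬝ᵥ f = 0) :
    gap P * ∑ x, p x * f x ^ 2 ≤ ∑ x, p x * (f x * (f x - (P *ᵥ f) x)) := by
  have hsqrt : ∀ x, √(p x) ≠ 0 := fun x => (Real.sqrt_pos.2 (hp x)).ne'
  have hsq : ∀ x, √(p x) * √(p x) = p x := fun x => Real.mul_self_sqrt (hp x).le
  -- Conjugation by `√p` turns `P`, which is self-adjoint on `ℓ²(p)`, into a symmetric matrix.
  set A : Matrix Ω Ω ℝ := Matrix.of fun x y => √(p x) * P x y / √(p y) with hAdef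
  have hA : A.IsHermitian := by
    ext x y
    simp only [hAdef, Matrix.conjTranspose_apply, Matrix.of_apply, star_trivial]
    rw [div_eq_div_iff (hsqrt x) (hsqrt y)]
    linear_combination (P y x * hsq y - P x y * hsq x) - hrev x y
  have hAmul : ∀ g : Ω → ℝ, A *ᵥ (fun x => √(p x) * g x) = fun x => √(p x) * (P *ᵥ g) x := by
    intro g
    ext x
    simp only [hAdef, Matrix.mulVec, dotProduct, Matrix.of_apply, mul_sum]
    exact sum_congr rfl fun y _ => by field_simp [hsqrt y]
  have hdot : ∀ g h : Ω → ℝ,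
      (fun x => √(p x) * g x) ⬝ᵥ (fun x => √(p x) * h x) = ∑ x, p x * (g x * h x) :=
    fun g h => sum_congr rfl fun x _ => by rw [mul_mul_mul_comm, hsq]
  have hrayleigh : (∑ x, p x * (f x * (P *ᵥ f) x)) ≤ lam P * ∑ x, p x * (f x * f x) := by
    rw [← hdot, ← hdot, ← hAmul]
    refine dotProduct_mulVec_le_of_isHermitian hA fun μ z hμ hAz => ?_
    obtain ⟨g, rfl⟩ : ∃ g : Ω → ℝ, z = fun x => √(p x) * g x :=
      ⟨fun x => z x / √(p x), funext fun x => (mul_div_cancel₀ _ (hsqrt x)).symm⟩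
    rw [hdot]
    refine sum_mul_eq_zero_of_lam_lt hP hirr hf hμ (funext fun x => ?_)
    refine mul_left_cancel₀ (hsqrt x) ((congrFun ((hAmul g).symm.trans hAz) x).trans ?_)
    exact mul_left_comm μ _ _
  simp only [mul_sub, sum_sub_distrib, gap, sub_mul, one_mul, sq]
  exact sub_le_sub_left hrayleigh _

end Reversible

/-! ### The rates of a birth-and-death kernel -/

/-- Extension by zero of a vector indexed by the states `{0, …, N}`. -/
noncomputable def extend (f : Fin (N + 1) → ℝ) : ℕ → ℝ := Function.extend Fin.val f 0

/-- The up probabilities of a kernel on `{0, …, N}`, zero beyond `N - 1`. -/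
noncomputable def up (P : Matrix (Fin (N + 1)) (Fin (N + 1)) ℝ) (x : ℕ) : ℝ :=
  extend (fun z => extend (P z) (x + 1)) x

/-- The down probabilities of a kernel on `{0, …, N}`, zero at `0` and beyond `N`. -/
noncomputable def down (P : Matrix (Fin (N + 1)) (Fin (N + 1)) ℝ) (x : ℕ) : ℝ :=
  if x = 0 then 0 else extend (fun z => extend (P z) (x - 1)) x

lemma extend_val (f : Fin (N + 1) → ℝ) (x : Fin (N + 1)) : extend f x = f x :=
  Fin.val_injective.extend_apply f 0 x

lemma extend_of_lt (f : Fin (N + 1) → ℝ) {x : ℕ} (hx : N < x) : extend f x = 0 :=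
  Function.extend_apply' f (0 : ℕ → ℝ) x fun ⟨_, _⟩ => by omega

lemma mean_extend (q : Fin (N + 1) → ℝ) (f : ℕ → ℝ) :
    mean N (extend q) f = ∑ y : Fin (N + 1), q y * f y := by
  simp only [mean_apply, ← Fin.sum_univ_eq_sum_range fun y => extend q y * f y, extend_val]

section Kernel

variable {P : Matrix (Fin (N + 1)) (Fin (N + 1)) ℝ} {p : Fin (N + 1) → ℝ}

lemma up_of_val_eq {x y : Fin (N + 1)} (h : (y : ℕ) = x + 1) : up P x = P x y := by
  rw [up, extend_val, ← h, extend_val]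

lemma down_of_val_eq {x y : Fin (N + 1)} (h : (x : ℕ) = y + 1) : down P x = P x y := by
  rw [down, if_neg (by omega), extend_val, h, Nat.add_sub_cancel, extend_val]

lemma up_top (P : Matrix (Fin (N + 1)) (Fin (N + 1)) ℝ) : up P N = 0 :=
  (extend_val _ (Fin.last N)).trans (extend_of_lt _ N.lt_succ_self)

namespace IsBirthDeath

lemma mulVec_eq_step (hBD : IsBirthDeath P) (f : ℕ → ℝ) (x : Fin (N + 1)) :
    (P *ᵥ fun y => f y) x = step (up P) (down P) f x := by
  have hterm : ∀ y : Fin (N + 1), P x y * (f y - f x) =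
      (if (y : ℕ) = x + 1 then up P x * (f (x + 1) - f x) else 0) +
        if (y : ℕ) = x - 1 then down P x * (f (x - 1) - f x) else 0 := by
    intro y
    by_cases hup : (y : ℕ) = x + 1
    · rw [if_pos hup, if_neg (by omega), add_zero, up_of_val_eq hup, hup]
    by_cases hdown : (x : ℕ) = y + 1
    · rw [if_neg hup, if_pos (by omega), zero_add, down_of_val_eq hdown, hdown,
        Nat.add_sub_cancel]
    by_cases hxy : y = x
    · subst hxy
      rcases eq_or_ne (y : ℕ) 0 with h | h <;> simp [h]
      omega
    · rw [if_neg hup, if_neg (by omega), hBD.nearest x y (by omega), zero_mul, add_zero]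
  have hsum : ∑ y, P x y * (f y - f x) =
      up P x * (f (x + 1) - f x) + down P x * (f (x - 1) - f x) := by
    rw [sum_congr rfl fun y _ => hterm y, sum_add_distrib,
      Fin.sum_univ_eq_sum_range (fun y => if y = (x : ℕ) + 1 then _ else _),
      Fin.sum_univ_eq_sum_range (fun y => if y = (x : ℕ) - 1 then _ else _), sum_ite_eq',
      sum_ite_eq', if_pos (mem_range.2 (by omega) : (x : ℕ) - 1 ∈ range (N + 1))]
    split_ifs with hx
    · rfl
    · rw [show (x : ℕ) = N by grind, up_top, zero_mul]
  rw [step_apply, add_assoc, ← hsum]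
  simp only [mul_sub, sum_sub_distrib, ← sum_mul, Matrix.mulVec, dotProduct,
    Matrix.sum_row_of_mem_rowStochastic hBD.stochastic, one_mul, add_sub_cancel]

lemma pow_mulVec (hBD : IsBirthDeath P) (f : ℕ → ℝ) (t : ℕ) (x : Fin (N + 1)) :
    (P ^ t *ᵥ fun y => f y) x = (step (up P) (down P) ^ t) f x := by
  induction t generalizing x with
  | zero => rw [pow_zero, pow_zero, Matrix.one_mulVec, Module.End.one_apply]
  | succ t ih =>
    rw [pow_succ', pow_succ', ← Matrix.mulVec_mulVec, Module.End.mul_apply,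
      ← hBD.mulVec_eq_step, funext ih]

lemma pow_apply (hBD : IsBirthDeath P) (t : ℕ) (x y : Fin (N + 1)) :
    (P ^ t) x y = (step (up P) (down P) ^ t) (Pi.single (y : ℕ) 1) x := by
  have hsingle : (fun z : Fin (N + 1) => (Pi.single (y : ℕ) 1 : ℕ → ℝ) z) = Pi.single y 1 := by
    ext z
    simp only [Pi.single_apply, Fin.ext_iff]
  rw [← hBD.pow_mulVec, hsingle, Matrix.mulVec_single_one, Matrix.col_apply]

lemma up_add_down (hBD : IsBirthDeath P) (x : Fin (N + 1)) : up P x + down P x = 1 - P x x := by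
  have hstep := hBD.pow_apply 1 x x
  rw [pow_one, pow_one, step_apply, Pi.single_eq_same, Pi.single_eq_of_ne (by omega)] at hstep
  rcases eq_or_ne (x : ℕ) 0 with hx | hx
  · have hdown : down P x = 0 := if_pos hx
    rw [hdown] at hstep ⊢
    linarith
  · rw [Pi.single_eq_of_ne (by omega)] at hstep
    linarith

lemma balance (hBD : IsBirthDeath P) (hp : IsStationary P p) {x : ℕ} (hx : x < N) :
    extend p x * up P x = extend p (x + 1) * down P (x + 1) := by
  -- The two sides are the stationary flows across the edge `{x, x + 1}`, that is, out of and into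
  -- `{0, …, x}`.
  have hflow : step (up P) (down P) (below x) - below x =
      down P (x + 1) • Pi.single (x + 1) 1 - up P x • Pi.single x 1 := by
    ext y
    simp only [step_apply, below, Pi.sub_apply, Pi.smul_apply, Pi.single_apply, smul_eq_mul]
    rcases lt_trichotomy y x with h | rfl | h
    · simp [h.le, h.ne, show y + 1 ≤ x by omega, show y - 1 ≤ x by omega,
        show y ≠ x + 1 by omega]
    · simp
    rcases h.nat_succ_le.eq_or_lt with rfl | h
    · simp
    · simp [h.ne', show ¬ y ≤ x by omega, show ¬ y < x by omega, show ¬ y ≤ x + 1 by omega,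
        show y ≠ x by omega]
  have hfix : mean N (extend p) (step (up P) (down P) (below x)) =
      mean N (extend p) (below x) := by
    rw [mean_extend, mean_extend]
    simp only [← hBD.mulVec_eq_step]
    exact (Matrix.dotProduct_mulVec p P _).trans (by rw [hp.2]; rfl)
  have hmean := congrArg (mean N (extend p)) hflow
  rw [map_sub, map_sub, map_smul, map_smul, hfix, sub_self, mean_single hx.le, mean_single hx,
    smul_eq_mul, smul_eq_mul] at hmean
  linarith

lemma up_pos (hBD : IsBirthDeath P) (hirr : P.IsIrreducible) {x : ℕ} (hx : x < N) :
    0 < up P x := by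
  rw [up_of_val_eq (x := ⟨x, by omega⟩) (y := ⟨x + 1, by omega⟩) rfl]
  refine (hirr.nonneg _ _).lt_of_ne fun hup => ?_
  have hblock : ∀ a b : Fin (N + 1), (a : ℕ) ≤ x → x < (b : ℕ) → P a b = 0 := by
    intro a b ha hb
    by_cases hab : (a : ℕ) = x ∧ (b : ℕ) = x + 1
    · exact (congrArg₂ P (Fin.ext hab.1) (Fin.ext hab.2)).trans hup.symm
    · exact hBD.nearest a b (by omega)
  have hpow : ∀ (k : ℕ) (a b : Fin (N + 1)), (a : ℕ) ≤ x → x < (b : ℕ) → (P ^ k) a b = 0 := by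
    intro k
    induction k with
    | zero => exact fun a b ha hb => Matrix.one_apply_ne (by grind)
    | succ k ih =>
      intro a b ha hb
      rw [pow_succ, Matrix.mul_apply]
      refine sum_eq_zero fun z _ => ?_
      rcases le_or_gt (z : ℕ) x with hz | hz
      · rw [hblock z b hz hb, mul_zero]
      · rw [ih a z ha hz, zero_mul]
  obtain ⟨k, -, hk⟩ := (Matrix.isIrreducible_iff_exists_pow_pos hirr.nonneg).1 hirr 0 (Fin.last N)
  exact hk.ne' (hpow k _ _ x.zero_le hx)

end IsBirthDeath

/-- `P` is the kernel of an irreducible lazy birth-and-death chain with stationary distribution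
`p`: the standing assumptions of the theorem, for a single chain. -/
structure IsLazyBirthDeath (P : Matrix (Fin (N + 1)) (Fin (N + 1)) ℝ) (p : Fin (N + 1) → ℝ) :
    Prop where
  birthDeath : IsBirthDeath P
  lazy : IsLazy P
  irreducible : P.IsIrreducible
  stationary : IsStationary P p

namespace IsLazyBirthDeath

lemma rates (h : IsLazyBirthDeath P p) : Rates N (extend p) (up P) (down P) where
  w_pos x hx := (extend_val p ⟨x, by omega⟩).symm ▸ h.stationary.pos h.irreducible _
  sum_w := by
    rw [← Fin.sum_univ_eq_sum_range, ← h.stationary.1.2]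
    exact sum_congr rfl fun x _ => extend_val p x
  u_pos _ hx := h.birthDeath.up_pos h.irreducible hx
  u_top := up_top P
  d_zero := if_pos rfl
  lazy x hx := by
    have hsum := h.birthDeath.up_add_down ⟨x, by omega⟩
    have hstay := h.lazy ⟨x, by omega⟩
    linarith
  balance _ hx := h.birthDeath.balance h.stationary hx

lemma isReversible (h : IsLazyBirthDeath P p) : IsReversible P p := by
  intro x y
  have hbal := h.rates.pow_step_single_balance 1 x.is_le y.is_le
  rwa [← h.birthDeath.pow_apply, ← h.birthDeath.pow_apply, pow_one, extend_val, extend_val] at hbal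

lemma poincare (h : IsLazyBirthDeath P p) : Poincare N (extend p) (up P) (trel P) := by
  intro f
  set g : ℕ → ℝ := f - fun _ => mean N (extend p) f with hg
  have hmean : p ⬝ᵥ (fun x => g x) = 0 := by
    rw [dotProduct, ← mean_extend, hg, map_sub, h.rates.mean_const, sub_self]
  have hgap := h.isReversible.gap_mul_le (h.stationary.pos h.irreducible) h.birthDeath.stochastic
    h.irreducible hmean
  have hvar : ∑ x, p x * g x ^ 2 = variance N (extend p) f :=
    (mean_extend p fun x => g x ^ 2).symm
  have hdir : ∑ x, p x * (g x * (g x - (P *ᵥ fun y => g y) x)) =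
      dirichlet N (extend p) (up P) f := by
    simp only [h.birthDeath.mulVec_eq_step]
    rw [← mean_extend p fun x => g x * (g x - step (up P) (down P) g x)]
    have hparts := h.rates.mean_mul_step_sub g g
    rw [← neg_sub g, mul_neg, map_neg, neg_inj] at hparts
    refine hparts.trans (sum_congr rfl fun j _ => ?_)
    simp only [hg, Pi.sub_apply, sub_sub_sub_cancel_right, sq]
  rwa [hvar, hdir, ← le_inv_mul_iff₀ (gap_pos h.birthDeath.stochastic h.lazy)] at hgap

lemma discrepancy_le_worstDist (h : IsLazyBirthDeath P p) (t : ℕ) (x : Fin (N + 1)) {f : ℕ → ℝ}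
    (hf₀ : ∀ y ≤ N, 0 ≤ f y) (hf₁ : ∀ y ≤ N, f y ≤ 1) :
    discrepancy N (extend p) (up P) (down P) t x f ≤ worstDist P p t := by
  rw [discrepancy_apply, ← h.birthDeath.pow_mulVec, mean_extend]
  exact h.stationary.pow_mulVec_sub_le_worstDist h.birthDeath.stochastic t (fun y => hf₀ y y.is_le)
    (fun y => hf₁ y y.is_le) x

lemma worstDist_le (h : IsLazyBirthDeath P p) {t : ℕ} {A B : ℝ}
    (hA : ∀ k ≤ N, discrepancy N (extend p) (up P) (down P) t 0 (below k) ≤ A)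
    (hB : ∀ k ≤ N, discrepancy N (reflect N (extend p)) (reflect N (down P)) (reflect N (up P)) t 0
      (below k) ≤ B) : worstDist P p t ≤ A + B := by
  refine ciSup_le fun x => ?_
  rw [tv_eq_sum_max_sub (h.stationary.sum_pow_row h.birthDeath.stochastic t x)]
  refine le_trans (le_of_eq ?_) (h.rates.sum_max_sub_le hA hB x.is_le)
  rw [← Fin.sum_univ_eq_sum_range
    fun y => max 0 ((step (up P) (down P) ^ t) (Pi.single y 1) x - extend p y)]
  simp only [← h.birthDeath.pow_apply, extend_val]

end IsLazyBirthDeath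

end Kernel

/-! ### Mixing times -/

section MixingTime

variable {P : Matrix (Fin (N + 1)) (Fin (N + 1)) ℝ} {p : Fin (N + 1) → ℝ}

lemma sqrt_mul_div_le {B g η : ℝ} (hη : 0 < η) (hB : 0 ≤ B) (hg : 0 ≤ g) :
    √(2 * B * g) / η ≤ B / 2 + g / η ^ 2 := by
  rw [div_le_iff₀ hη, show (B / 2 + g / η ^ 2) * η = B / 2 * η + g / η by field_simp]
  refine Real.sqrt_le_iff.2 ⟨by positivity, ?_⟩
  have hamgm : (B / 2 * η + g / η) ^ 2 - 2 * B * g = (B / 2 * η - g / η) ^ 2 := by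
    field_simp
    ring
  linarith [sq_nonneg (B / 2 * η - g / η)]

lemma le_mul_of_sub_sqrt_le {A B g T η : ℝ} (hη : 0 < η) (hB : 0 ≤ B) (hg : 0 ≤ g)
    (hAB : A - B ≤ 2 * g / η) (hgT : g ≤ 2 * T) (hBT : B - √(2 * B * g) / η ≤ T) :
    A ≤ (2 + 4 / η + 4 / η ^ 2) * T := by
  have hsqrt := sqrt_mul_div_le hη hB hg
  have hlin : 2 * g / η ≤ 2 * (2 * T) / η := by gcongr
  have hsq : g / η ^ 2 ≤ 2 * T / η ^ 2 := by gcongr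
  calc A ≤ 2 * T + 2 * (2 * T) / η + 2 * (2 * T / η ^ 2) := by linarith
    _ = (2 + 4 / η + 4 / η ^ 2) * T := by ring

lemma add_sqrt_sub_le_mul_sqrt {A B g T τ η : ℝ} (hη : 0 < η) (hB : 0 ≤ B) (hBA : B ≤ A)
    (hAB : A - B ≤ 2 * g / η) (hg : 1 ≤ g) (hgT : g ≤ 2 * T)
    (hBτ : B - √(2 * B * g) / η ≤ τ) (hτT : τ ≤ T) :
    A + √(2 * A * g) / η + 1 - τ ≤
      (4 / η + 2 * (√(2 * (2 + 4 / η + 4 / η ^ 2)) / η) + 2) * √(T * g) := by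
  have hg₀ : 0 ≤ g := by linarith
  have hgD : g ≤ 2 * √(T * g) := by
    have := Real.abs_le_sqrt (x := g / 2) (y := T * g) (by nlinarith)
    linarith [le_abs_self (g / 2)]
  have hA : √(2 * A * g) ≤ √(2 * (2 + 4 / η + 4 / η ^ 2)) * √(T * g) := by
    rw [← Real.sqrt_mul (by positivity), mul_assoc 2 (_ + _), ← mul_assoc (_ + _), ← mul_assoc 2]
    gcongr
    exact le_mul_of_sub_sqrt_le hη hB hg₀ hAB hgT (hBτ.trans hτT)
  have hsqrtBA : √(2 * B * g) / η ≤ √(2 * A * g) / η := by gcongr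
  calc A + √(2 * A * g) / η + 1 - τ ≤ 2 * g / η + 2 * (√(2 * A * g) / η) + g := by linarith
    _ ≤ 2 * (2 * √(T * g)) / η
        + 2 * (√(2 * (2 + 4 / η + 4 / η ^ 2)) * √(T * g) / η) + 2 * √(T * g) := by gcongr
    _ = _ := by ring

namespace IsLazyBirthDeath

lemma gap_pos (h : IsLazyBirthDeath P p) : 0 < gap P :=
  BDChain.gap_pos h.birthDeath.stochastic h.lazy

lemma one_le_trel (h : IsLazyBirthDeath P p) : 1 ≤ trel P :=
  (one_le_inv₀ h.gap_pos).2 (gap_le_one P)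

lemma exists_mixing_bounds (h : IsLazyBirthDeath P p) {ε : ℝ} (hε : 0 < ε) (hε₂ : ε ≤ 1 / 2) :
    ∃ A B : ℝ, 0 ≤ B ∧ B ≤ A ∧ A - B ≤ 2 * trel P / ε ∧
      (∀ t : ℕ, A + √(2 * A * trel P) / ε < t → worstDist P p t ≤ 4 * ε) ∧
      ∀ t : ℕ, t < B - √(2 * B * trel P) / ε → 1 - 2 * ε < worstDist P p t := by
  have hr : 0 ≤ trel P := zero_le_one.trans h.one_le_trel
  obtain ⟨A, B, hB, hBA, hAB, hlate, hearly⟩ := h.rates.exists_passage_bounds h.poincare hr hε hε₂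
  obtain ⟨A', B', hB', hBA', hAB', hlate', hearly'⟩ :=
    h.rates.reflect.exists_passage_bounds (h.poincare.reflect h.rates) hr hε hε₂
  have hupper : ∀ t : ℕ, A + √(2 * A * trel P) / ε < t → A' + √(2 * A' * trel P) / ε < t →
      worstDist P p t ≤ 4 * ε := fun t ht ht' => by
    linarith [h.worstDist_le (hlate t ht) (hlate' t ht')]
  have hmono : ∀ {a b : ℝ}, a ≤ b → a + √(2 * a * trel P) / ε ≤ b + √(2 * b * trel P) / ε :=
    fun hab => by gcongr
  rcases le_total A' A with hAA | hAA
  · refine ⟨A, B, hB, hBA, hAB, fun t ht => hupper t ht ((hmono hAA).trans_lt ht), fun t ht => ?_⟩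
    obtain ⟨k, -, hk⟩ := hearly t ht
    exact hk.trans_le (h.discrepancy_le_worstDist t 0 (fun y _ => below_nonneg k y)
      fun y _ => below_le_one k y)
  · refine ⟨A', B', hB', hBA', hAB', fun t ht => hupper t ((hmono hAA).trans_lt ht) ht,
      fun t ht => ?_⟩
    obtain ⟨k, -, hk⟩ := hearly' t ht
    have hreflect := h.rates.discrepancy_reflect t (below k) (le_refl N)
    rw [Nat.sub_self] at hreflect
    rw [← hreflect] at hk
    exact hk.trans_le (h.discrepancy_le_worstDist t (Fin.last N) (fun y _ => below_nonneg k _)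
      fun y _ => below_le_one k _)

lemma worstDist_tmix_le (h : IsLazyBirthDeath P p) {ε : ℝ} (hε : 0 < ε) :
    worstDist P p (tmix P p ε) ≤ ε := by
  refine Nat.sInf_mem (s := {t | worstDist P p t ≤ ε}) ?_
  obtain ⟨A, -, -, -, -, hlate, -⟩ :=
    h.exists_mixing_bounds (ε := min (ε / 4) (1 / 2)) (by positivity) (min_le_right _ _)
  obtain ⟨t, ht⟩ := exists_nat_gt (A + √(2 * A * trel P) / min (ε / 4) (1 / 2))
  exact ⟨t, (hlate t ht).trans (by linarith [min_le_left (ε / 4) (1 / 2)])⟩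

lemma tmix_anti (h : IsLazyBirthDeath P p) {ε δ : ℝ} (hε : 0 < ε) (hεδ : ε ≤ δ) :
    tmix P p δ ≤ tmix P p ε :=
  tmix_le ((h.worstDist_tmix_le hε).trans hεδ)

lemma tmix_pos (h : IsLazyBirthDeath P p) (hN : 1 ≤ N) {ε : ℝ} (hε : 0 < ε) (hε₂ : ε < 1 / 2) :
    0 < tmix P p ε := by
  have : Nontrivial (Fin (N + 1)) := Fin.nontrivial_iff_two_le.2 (by omega)
  refine Nat.pos_of_ne_zero fun hzero => ?_
  have hlow := h.stationary.half_le_worstDist_zero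
  have hle := h.worstDist_tmix_le hε
  rw [hzero] at hle
  linarith

lemma half_le_tmix_mul_gap (h : IsLazyBirthDeath P p) (hN : 1 ≤ N) :
    1 / 2 ≤ (tmix P p (1 / 4) : ℝ) * gap P := by
  have hpow := h.stationary.lam_pow_le
    (h.tmix_pos hN (ε := 1 / 4) (by norm_num) (by norm_num)).ne'
  have hle := h.worstDist_tmix_le (ε := 1 / 4) (by norm_num)
  have hbernoulli := one_add_mul_le_pow (a := -gap P) (by linarith [gap_le_one P])
    (tmix P p (1 / 4))
  rw [show 1 + -gap P = lam P by rw [gap]; ring] at hbernoulli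
  linarith

end IsLazyBirthDeath

lemma exists_tmix_sub_le {ε : ℝ} (hε : 0 < ε) (hε₂ : ε < 1 / 2) :
    ∃ c : ℝ, 0 < c ∧ ∀ {N : ℕ} {P : Matrix (Fin (N + 1)) (Fin (N + 1)) ℝ} {p : Fin (N + 1) → ℝ},
      1 ≤ N → IsLazyBirthDeath P p →
      (tmix P p ε : ℝ) - tmix P p (1 - ε) ≤ c * √(tmix P p (1 / 4) * trel P) := by
  set η := ε / 4 with hη
  have hη₀ : 0 < η := by positivity
  refine ⟨4 / η + 2 * (√(2 * (2 + 4 / η + 4 / η ^ 2)) / η) + 2, by positivity, ?_⟩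
  intro N P p hN h
  obtain ⟨A, B, hB, hBA, hAB, hlate, hearly⟩ := h.exists_mixing_bounds hη₀ (by linarith)
  have hlower : B - √(2 * B * trel P) / η ≤ tmix P p (1 - ε) := by
    by_contra! hlt
    linarith [hearly _ hlt, h.worstDist_tmix_le (ε := 1 - ε) (by linarith)]
  have hupper : (tmix P p ε : ℝ) ≤ A + √(2 * A * trel P) / η + 1 := by
    set s := A + √(2 * A * trel P) / η
    have hfloor : tmix P p ε ≤ ⌊s⌋₊ + 1 :=
      tmix_le ((hlate _ (by exact_mod_cast Nat.lt_floor_add_one s)).trans (by linarith))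
    have hs : 0 ≤ s := add_nonneg (hB.trans hBA) (by positivity)
    calc (tmix P p ε : ℝ) ≤ ⌊s⌋₊ + 1 := by exact_mod_cast hfloor
      _ ≤ s + 1 := by linarith [Nat.floor_le hs]
  have hrel : trel P ≤ 2 * tmix P p (1 / 4) := by
    rw [trel, inv_le_iff_one_le_mul₀ h.gap_pos]
    linarith [h.half_le_tmix_mul_gap hN]
  have hquarter : (tmix P p (1 - ε) : ℝ) ≤ tmix P p (1 / 4) :=
    Nat.cast_le.2 (h.tmix_anti (by norm_num) (by linarith))
  linarith [add_sqrt_sub_le_mul_sqrt hη₀ hB hBA hAB h.one_le_trel hrel hlower hquarter]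

lemma exp_neg_two_mul_le {x : ℝ} (hx : 0 ≤ x) (hx₂ : x ≤ 1 / 2) : Real.exp (-(2 * x)) ≤ 1 - x := by
  rw [Real.exp_neg, inv_le_comm₀ (Real.exp_pos _) (by linarith)]
  refine le_trans ?_ (Real.add_one_le_exp (2 * x))
  rw [inv_le_iff_one_le_mul₀ (by linarith)]
  nlinarith

lemma IsLazyBirthDeath.exp_neg_tmix_mul_gap_le (h : IsLazyBirthDeath P p) {ε : ℝ} (hε : 0 < ε)
    (hpos : tmix P p (1 - ε) ≠ 0) (hpos' : tmix P p ε ≠ 0) :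
    Real.exp (-(2 * (tmix P p ε * gap P))) ≤ 2 * ε := by
  have hdist := h.worstDist_tmix_le hε
  have hexp : ∀ {x : ℝ}, 0 ≤ x → x ≤ 1 / 2 → x ≤ gap P →
      Real.exp (-(2 * (tmix P p ε * gap P))) ≤ (1 - x) ^ tmix P p ε := by
    intro x hx hx₂ hxg
    refine le_trans ?_ (pow_le_pow_left₀ (Real.exp_pos _).le (exp_neg_two_mul_le hx hx₂) _)
    rw [← Real.exp_nat_mul, Real.exp_le_exp]
    nlinarith
  rcases le_or_gt (gap P) (1 / 2) with hg | hg
  · have hlam := h.stationary.lam_pow_le hpos'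
    have hle := hexp h.gap_pos.le hg le_rfl
    rw [gap, sub_sub_cancel] at hle
    exact hle.trans (by linarith)
  · obtain ⟨x, hx⟩ := h.stationary.exists_worstDist_zero_eq
    have hpx : p x < ε := by
      by_contra! hge
      exact hpos (Nat.le_zero.1 (tmix_le (by linarith)))
    have hstay := h.stationary.half_pow_sub_le_worstDist h.birthDeath.stochastic h.lazy
      (tmix P p ε) x
    have hle := hexp (x := 1 / 2) (by norm_num) le_rfl hg.le
    rw [show (1 : ℝ) - 1 / 2 = 1 / 2 by norm_num] at hle
    linarith

end MixingTime

/-! ### Sequences of chains -/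

lemma IsCutoffWindow.hasCutoff {T : ℕ → ℝ → ℕ} {v : ℕ → ℝ} (hv : IsCutoffWindow T v)
    (hanti : ∀ n {ε δ : ℝ}, 0 < ε → ε ≤ δ → T n δ ≤ T n ε) (hpos : ∀ n, T n (1 / 4) ≠ 0) :
    HasCutoff T := by
  have hpos' : ∀ n, (T n (1 / 4) : ℝ) ≠ 0 := fun n => Nat.cast_ne_zero.2 (hpos n)
  have hquarter : ∀ ε : ℝ, 0 < ε → ε < 1 →
      Tendsto (fun n => (T n ε : ℝ) / T n (1 / 4)) atTop (𝓝 1) := by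
    intro ε hε hε₁
    obtain ⟨δ, hδ, hδε⟩ : ∃ δ, 0 < δ ∧ δ ≤ min (1 / 4) (min ε (1 - ε)) :=
      ⟨_, lt_min (by norm_num) (lt_min hε (by linarith)), le_rfl⟩
    obtain ⟨hδ₄, hδε, hδε'⟩ := by simpa only [le_min_iff] using hδε
    obtain ⟨c, hc, hwidth⟩ := hv.2 δ hδ (by linarith)
    refine (isEquivalent_iff_tendsto_one (.of_forall hpos')).1
      ((IsBigO.of_bound c (.of_forall fun n => ?_)).trans_isLittleO hv.1)
    have hcast : ∀ {a b : ℝ}, 0 < a → a ≤ b → (T n b : ℝ) ≤ T n a :=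
      fun ha hab => Nat.cast_le.2 (hanti n ha hab)
    calc ‖(T n ε : ℝ) - T n (1 / 4)‖ ≤ T n δ - T n (1 - δ) := by
          rw [Real.norm_eq_abs, abs_le]
          constructor
          · linarith [hcast hδ hδ₄, hcast hε (show ε ≤ 1 - δ by linarith)]
          · linarith [hcast hδ hδε,
              hcast (a := 1 / 4) (by norm_num) (show 1 / 4 ≤ 1 - δ by linarith)]
      _ ≤ c * v n := hwidth n
      _ ≤ c * ‖v n‖ := by gcongr; exact Real.le_norm_self _
  intro ε hε hε₁
  have hratio := (hquarter ε hε hε₁).div (hquarter (1 - ε) (by linarith) (by linarith)) one_ne_zero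
  rw [div_one] at hratio
  exact hratio.congr fun n => div_div_div_cancel_right₀ (hpos' n) _ _

lemma isLittleO_sqrt_mul_inv {T g : ℕ → ℝ} (hT : ∀ n, 0 ≤ T n)
    (h : Tendsto (fun n => T n * g n) atTop atTop) :
    (fun n => √(T n * (g n)⁻¹)) =o[atTop] T := by
  have hroot : Tendsto (fun n => √(T n * g n)⁻¹) atTop (𝓝 0) := by
    simpa only [Function.comp_def, Pi.inv_apply, Real.sqrt_zero] using
      (Real.continuous_sqrt.tendsto 0).comp h.inv_tendsto_atTop
  refine isLittleO_of_tendsto (fun n hn => by rw [hn, zero_mul, Real.sqrt_zero])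
    (hroot.congr' ?_)
  filter_upwards [h.eventually_gt_atTop 0] with n hn
  have hTn : T n ≠ 0 := left_ne_zero_of_mul hn.ne'
  rw [eq_div_iff hTn]
  nth_rw 2 [← Real.sqrt_sq (hT n)]
  rw [← Real.sqrt_mul (inv_nonneg.2 hn.le)]
  congr 1
  field_simp

section Sequence

variable {N : ℕ → ℕ} {P : (n : ℕ) → Matrix (Fin (N n + 1)) (Fin (N n + 1)) ℝ}
  {p : (n : ℕ) → Fin (N n + 1) → ℝ}

lemma isCutoffWindow_of_tendsto (hN : ∀ n, 1 ≤ N n) (h : ∀ n, IsLazyBirthDeath (P n) (p n))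
    (hlim : Tendsto (fun n => (tmix (P n) (p n) (1 / 4) : ℝ) * gap (P n)) atTop atTop) :
    IsCutoffWindow (fun n => tmix (P n) (p n))
      (fun n => √((tmix (P n) (p n) (1 / 4) : ℝ) * trel (P n))) := by
  refine ⟨isLittleO_sqrt_mul_inv (fun n => Nat.cast_nonneg _) hlim, fun ε hε hε₁ => ?_⟩
  rcases lt_or_ge ε (1 / 2) with hε₂ | hε₂
  · obtain ⟨c, hc, hwidth⟩ := exists_tmix_sub_le hε hε₂
    exact ⟨c, hc, fun n => hwidth (hN n) (h n)⟩
  · refine ⟨1, one_pos, fun n => ?_⟩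
    have hle : (tmix (P n) (p n) ε : ℝ) ≤ tmix (P n) (p n) (1 - ε) :=
      Nat.cast_le.2 ((h n).tmix_anti (by linarith) (by linarith))
    rw [one_mul]
    exact (sub_nonpos.2 hle).trans (Real.sqrt_nonneg _)

lemma tendsto_tmix_mul_gap_of_hasCutoff (h : ∀ n, IsLazyBirthDeath (P n) (p n))
    (hcut : HasCutoff (fun n => tmix (P n) (p n))) :
    Tendsto (fun n => (tmix (P n) (p n) (1 / 4) : ℝ) * gap (P n)) atTop atTop := by
  refine tendsto_atTop.2 fun C => ?_
  set ε := Real.exp (-(4 * |C|)) / 4 with hε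
  have hexp : Real.exp (-(4 * |C|)) ≤ 1 := Real.exp_le_one_iff.2 (by linarith [abs_nonneg C])
  have hε₀ : 0 < ε := by positivity
  filter_upwards [(hcut ε hε₀ (by linarith)).eventually
    (Ioo_mem_nhds (zero_lt_one' ℝ) (one_lt_two : (1 : ℝ) < 2))] with n hn
  have hden : tmix (P n) (p n) (1 - ε) ≠ 0 := fun hzero => by simp [hzero] at hn
  have hnum : tmix (P n) (p n) ε ≠ 0 := fun hzero => by simp [hzero] at hn
  have hquarter : (tmix (P n) (p n) (1 - ε) : ℝ) ≤ tmix (P n) (p n) (1 / 4) :=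
    Nat.cast_le.2 ((h n).tmix_anti (by norm_num) (by linarith))
  have hdouble : (tmix (P n) (p n) ε : ℝ) ≤ 2 * tmix (P n) (p n) (1 / 4) := by
    linarith [(div_lt_iff₀ (by positivity)).1 hn.2]
  by_contra! hlt
  have hbound : tmix (P n) (p n) ε * gap (P n) ≤ 2 * |C| := by
    nlinarith [(h n).gap_pos, le_abs_self C]
  have hdecay := (h n).exp_neg_tmix_mul_gap_le hε₀ hden hnum
  have hmono : Real.exp (-(4 * |C|)) ≤ Real.exp (-(2 * (tmix (P n) (p n) ε * gap (P n)))) :=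
    Real.exp_le_exp.2 (by linarith)
  linarith

end Sequence

end BDChain

theorem corollary1 (N : ℕ → ℕ) (hN : ∀ n, 1 ≤ N n)
    (P : (n : ℕ) → Matrix (Fin (N n + 1)) (Fin (N n + 1)) ℝ)
    (hBD : ∀ n, BDChain.IsBirthDeath (P n))
    (hlazy : ∀ n, BDChain.IsLazy (P n))
    (hirr : ∀ n, (P n).IsIrreducible)
    (p : (n : ℕ) → Fin (N n + 1) → ℝ)
    (hp : ∀ n, BDChain.IsStationary (P n) (p n)) :
    (BDChain.HasCutoff (fun n => BDChain.tmix (P n) (p n)) ↔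
      Tendsto (fun n => (BDChain.tmix (P n) (p n) (1 / 4) : ℝ) * BDChain.gap (P n))
        atTop atTop) ∧
    (BDChain.HasCutoff (fun n => BDChain.tmix (P n) (p n)) →
      BDChain.IsCutoffWindow (fun n => BDChain.tmix (P n) (p n))
        (fun n => √((BDChain.tmix (P n) (p n) (1 / 4) : ℝ) * BDChain.trel (P n)))) := by
  have hchain : ∀ n, BDChain.IsLazyBirthDeath (P n) (p n) :=
    fun n => ⟨hBD n, hlazy n, hirr n, hp n⟩
  have hwindow := BDChain.isCutoffWindow_of_tendsto hN hchain
  have hlim := BDChain.tendsto_tmix_mul_gap_of_hasCutoff hchain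
  exact ⟨⟨hlim, fun h => (hwindow h).hasCutoff (fun n => (hchain n).tmix_anti)
    fun n => ((hchain n).tmix_pos (hN n) (by norm_num) (by norm_num)).ne'⟩,
    fun h => hwindow (hlim h)⟩
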